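/- Let $(M,g)$ be a smooth oriented Riemannian four-manifold with Levi-Civita connection $\nabla$, whose Weyl tensor $C_{abcd}$ vanishes at no point and is anti-self-dual, $C_{abcd}=-\frac12\,\epsilon_{ab}{}^{ef}C_{cdef}$, where $\epsilon_{abcd}$ is the volume form. Let $P_{ab}=\frac12 R_{ab}-\frac1{12}R\,g_{ab}$ be the Schouten tensor, where $R_{ab}$ is the Ricci tensor and $R$ the scalar curvature, with signs such that round spheres have positive curvature. Put $|C|^2=C_{abcd}C^{abcd}$, $$V_a=\frac{4}{|C|^2}\,C^{bcd}{}_a\,\nabla^eC_{bcde},\qquad T_{ab}=P_{ab}+\nabla_aV_b+V_aV_b-\tfrac12|V|^2g_{ab}.$$ Then the tensor $T_{ab}$ is conformally invariant: for every smooth positive function $\Omega$ on an open subset of $M$, the metrics $g$ and $\Omega^2g$ have the same tensor $T_{ab}$ there. Moreover, the conformal class of $g$ locally contains a Ricci-flat metric (that is, every point of $M$ has an open neighbourhood $U$ with a smooth function $\Omega>0$ on $U$ such that $\Omega^2g$ is Ricci-flat on $U$) if and only if $$4\,\nabla^eC_{bcde}\,\nabla_fC^{bcdf}-|V|^2|C|^2=0\qquad\text{and}\qquad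 T_{ab}=0$$ everywhere on $M$. -/

import Mathlib

open scoped Manifold ContDiff Topology

noncomputable section

/-- The model space `ℝ⁴`. -/
abbrev R4 : Type := EuclideanSpace ℝ (Fin 4)

/-! ### Tensor calculus in coordinates

Here `G : R4 → Matrix (Fin 4) (Fin 4) ℝ` is the matrix `G_{ab}(y)` of a metric in coordinates. -/

namespace Coord

/-- A metric in coordinates: a matrix-valued function of the coordinates. -/
abbrev MetricField : Type := R4 → Matrix (Fin 4) (Fin 4) ℝ

/-- The partial derivative `∂_a f` at `y`. -/
def pd (a : Fin 4) (f : R4 → ℝ) (y : R4) : ℝ :=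
  fderiv ℝ f y (EuclideanSpace.single a (1 : ℝ))

/-- The inverse metric `G^{ab}`. -/
def invMetric (G : MetricField) (y : R4) (a b : Fin 4) : ℝ := (G y)⁻¹ a b

/-- The Christoffel symbols `Γ^c_{ab}` of the Levi-Civita connection `∇` of `G`. -/
def christoffel (G : MetricField) (c a b : Fin 4) (y : R4) : ℝ :=
  (1 / 2) * ∑ d, invMetric G y c d *
    (pd a (fun z => G z b d) y + pd b (fun z => G z a d) y - pd d (fun z => G z a b) y)

/-- The curvature components `R_{ab}{}^c{}_d`, with
`(∇_a ∇_b - ∇_b ∇_a) X^c = R_{ab}{}^c{}_d X^d`. -/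
def curvature (G : MetricField) (a b c d : Fin 4) (y : R4) : ℝ :=
  pd a (christoffel G c b d) y - pd b (christoffel G c a d) y
    + ∑ m, (christoffel G c a m y * christoffel G m b d y
        - christoffel G c b m y * christoffel G m a d y)

/-- The Riemann tensor `R_{abcd} = G_{cm} R_{ab}{}^m{}_d`. -/
def riemann (G : MetricField) (a b c d : Fin 4) (y : R4) : ℝ :=
  ∑ m, G y c m * curvature G a b m d y

/-- The Ricci tensor, with the sign for which it is positive on round spheres. -/
def ricci (G : MetricField) (b d : Fin 4) (y : R4) : ℝ :=
  ∑ a, curvature G a b a d y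

/-- The scalar curvature, positive on round spheres. -/
def scalarCurv (G : MetricField) (y : R4) : ℝ :=
  ∑ a, ∑ b, invMetric G y a b * ricci G a b y

/-- The Schouten tensor `P_{ab}` in dimension four, normalised so that under `G ↦ Ω² G` it changes
by `-∇_a Υ_b + Υ_a Υ_b - ½ |Υ|² G_{ab}` with `Υ = d log Ω`. (For authors whose Ricci tensor is
negative on round spheres, this is `(1/12) R G_{ab} - (1/2) R_{ab}`.) -/
def schouten (G : MetricField) (a b : Fin 4) (y : R4) : ℝ :=
  (1 / 2) * ricci G a b y - (1 / 12) * scalarCurv G y * G y a b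

/-- The Weyl tensor `C_{abcd}`. -/
def weyl (G : MetricField) (a b c d : Fin 4) (y : R4) : ℝ :=
  riemann G a b c d y
    - (G y a c * schouten G b d y - G y a d * schouten G b c y
        + G y b d * schouten G a c y - G y b c * schouten G a d y)

/-- The covariant derivative `∇_f C_{abcd}` of the Weyl tensor. -/
def nablaWeyl (G : MetricField) (f a b c d : Fin 4) (y : R4) : ℝ :=
  pd f (weyl G a b c d) y
    - ∑ m, (christoffel G m f a y * weyl G m b c d y
        + christoffel G m f b y * weyl G a m c d y
        + christoffel G m f c y * weyl G a b m d y
        + christoffel G m f d y * weyl G a b c m y)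

/-- The divergence `∇^e C_{bcde}` of the Weyl tensor. -/
def divWeyl (G : MetricField) (b c d : Fin 4) (y : R4) : ℝ :=
  ∑ e, ∑ f, invMetric G y e f * nablaWeyl G f b c d e y

/-- The divergence `∇_f C^{bcdf}` of the Weyl tensor, with its free indices raised. -/
def divWeylUp (G : MetricField) (b c d : Fin 4) (y : R4) : ℝ :=
  ∑ b', ∑ c', ∑ d', invMetric G y b b' * invMetric G y c c' * invMetric G y d d' *
    divWeyl G b' c' d' y

/-- The Weyl tensor `C^{bcd}{}_a` with its first three indices raised. -/
def weylUp (G : MetricField) (b c d a : Fin 4) (y : R4) : ℝ :=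
  ∑ b', ∑ c', ∑ d', invMetric G y b b' * invMetric G y c c' * invMetric G y d d' *
    weyl G b' c' d' a y

/-- The squared norm `|C|² = C_{abcd} C^{abcd}` of the Weyl tensor. -/
def weylNormSq (G : MetricField) (y : R4) : ℝ :=
  ∑ a, ∑ b, ∑ c, ∑ d, ∑ d', weyl G a b c d y * (invMetric G y d d' * weylUp G a b c d' y)

/-- The one-form `V_a = 4 |C|⁻² C^{bcd}{}_a ∇^e C_{bcde}`. -/
def oneFormV (G : MetricField) (a : Fin 4) (y : R4) : ℝ :=
  4 / weylNormSq G y * ∑ b, ∑ c, ∑ d, weylUp G b c d a y * divWeyl G b c d y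

/-- The squared norm `|V|²`. -/
def normSqV (G : MetricField) (y : R4) : ℝ :=
  ∑ a, ∑ b, invMetric G y a b * oneFormV G a y * oneFormV G b y

/-- The covariant derivative `∇_a V_b`. -/
def nablaV (G : MetricField) (a b : Fin 4) (y : R4) : ℝ :=
  pd a (oneFormV G b) y - ∑ m, christoffel G m a b y * oneFormV G m y

/-- The scalar `4 ∇^e C_{bcde} ∇_f C^{bcdf} - |V|² |C|²`. -/
def scalarInvariant (G : MetricField) (y : R4) : ℝ :=
  4 * (∑ b, ∑ c, ∑ d, divWeyl G b c d y * divWeylUp G b c d y)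
    - normSqV G y * weylNormSq G y

/-- The tensor `T_{ab} = P_{ab} + ∇_a V_b + V_a V_b - ½ |V|² G_{ab}`. -/
def tensorT (G : MetricField) (a b : Fin 4) (y : R4) : ℝ :=
  schouten G a b y + nablaV G a b y + oneFormV G a y * oneFormV G b y
    - (1 / 2) * normSqV G y * G y a b

/-- The Levi-Civita symbol: the sign of `(a, b, c, d)` as a permutation of `(0, 1, 2, 3)`, and `0`
if two of the indices are equal. -/
def leviCivitaSymbol (a b c d : Fin 4) : ℝ :=
  Matrix.det (Matrix.of fun i j : Fin 4 => if ![a, b, c, d] i = j then (1 : ℝ) else 0)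

/-- The volume form `ε_{abcd}` of `G` in coordinates whose orientation is `s = ±1`. -/
def volumeForm (G : MetricField) (s : ℝ) (a b c d : Fin 4) (y : R4) : ℝ :=
  s * Real.sqrt (G y).det * leviCivitaSymbol a b c d

end Coord

/-! ### Manifolds -/

section Manifold

variable (M : Type*) [TopologicalSpace M] [ChartedSpace R4 M] [IsManifold (𝓡 4) ∞ M]

/-- A smooth Riemannian metric on the smooth 4-manifold `M`. -/
abbrev RiemannianMetric4 : Type _ :=
  Bundle.ContMDiffRiemannianMetric (𝓡 4) ∞ R4 (fun x : M => TangentSpace (𝓡 4) x)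

variable {M}

/-- The coordinate vector field `∂_a` of the chart `e`, at the point with coordinates `y`. -/
def coordVector (e : OpenPartialHomeomorph M R4) (y : R4) (a : Fin 4) :
    TangentSpace (𝓡 4) (e.symm y) :=
  mfderiv (𝓡 4) (𝓡 4) e.symm y (EuclideanSpace.single a (1 : ℝ) : R4)

/-- The components of a field `h` of bilinear forms on the tangent spaces in the chart `e`. -/
def components
    (h : ∀ x : M, TangentSpace (𝓡 4) x →L[ℝ] TangentSpace (𝓡 4) x →L[ℝ] ℝ)
    (e : OpenPartialHomeomorph M R4) : Coord.MetricField :=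
  fun y => Matrix.of fun a b => h (e.symm y) (coordVector e y a) (coordVector e y b)

/-- The metric `Ω² g`, as a field of bilinear forms. -/
def conformalMetric (Ω : M → ℝ) (g : RiemannianMetric4 M) (x : M) :
    TangentSpace (𝓡 4) x →L[ℝ] TangentSpace (𝓡 4) x →L[ℝ] ℝ :=
  (Ω x) ^ 2 • g.inner x

/-- The sign of the coordinate frame of `e` at the point with coordinates `y`, with respect to an
orientation of each tangent space of `M`. -/
def frameSign (o : ∀ x : M, Orientation ℝ (TangentSpace (𝓡 4) x) (Fin 4))
    (e : OpenPartialHomeomorph M R4) (y : R4) : ℝ :=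
  ((SignType.sign ((o (e.symm y)).someVector (coordVector e y)) : SignType) : ℝ)

variable (M) in
/-- An orientation of `M`: an orientation of each tangent space, depending continuously on the point
(the coordinate frame of each chart has locally constant sign). -/
structure ManifoldOrientation where
  /-- the orientation of each tangent space -/
  orient : ∀ x : M, Orientation ℝ (TangentSpace (𝓡 4) x) (Fin 4)
  locallyConstant : ∀ e ∈ IsManifold.maximalAtlas (𝓡 4) ∞ M, ∀ y ∈ e.target,
    ∀ᶠ z in 𝓝 y, frameSign orient e z = frameSign orient e y

/-- The Weyl tensor of `g` is anti-self-dual: `C_{abcd} = -½ ε_{ab}{}^{ef} C_{cdef}`. -/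
def IsAntiSelfDual (o : ManifoldOrientation M) (g : RiemannianMetric4 M) : Prop :=
  ∀ e ∈ IsManifold.maximalAtlas (𝓡 4) ∞ M, ∀ y ∈ e.target, ∀ a b c d : Fin 4,
    Coord.weyl (components g.inner e) a b c d y =
      -(1 / 2) * ∑ k, ∑ l, ∑ k', ∑ l',
        Coord.volumeForm (components g.inner e) (frameSign o.orient e y) a b k' l' y *
          Coord.invMetric (components g.inner e) y k' k *
          Coord.invMetric (components g.inner e) y l' l *
          Coord.weyl (components g.inner e) c d k l y

/-- The Weyl tensor of `g` vanishes at no point of `M`. -/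
def WeylNowhereZero (g : RiemannianMetric4 M) : Prop :=
  ∀ e ∈ IsManifold.maximalAtlas (𝓡 4) ∞ M, ∀ y ∈ e.target,
    ∃ a b c d : Fin 4, Coord.weyl (components g.inner e) a b c d y ≠ 0

/-- The metric `h` is Ricci-flat on the open set `U`. -/
def IsRicciFlatOn
    (h : ∀ x : M, TangentSpace (𝓡 4) x →L[ℝ] TangentSpace (𝓡 4) x →L[ℝ] ℝ) (U : Set M) : Prop :=
  ∀ e ∈ IsManifold.maximalAtlas (𝓡 4) ∞ M, ∀ y ∈ e.target, e.symm y ∈ U →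
    ∀ a b : Fin 4, Coord.ricci (components h e) a b y = 0

/-- `Ω` is an admissible conformal factor on `U`: smooth and positive. -/
def IsConformalFactorOn (Ω : M → ℝ) (U : Set M) : Prop :=
  ContMDiffOn (𝓡 4) 𝓘(ℝ, ℝ) ∞ Ω U ∧ ∀ x ∈ U, 0 < Ω x

/-- Locally, the conformal class of `g` contains a Ricci-flat metric: every point of `M` has an open
neighbourhood `U` on which some metric `Ω² g` is Ricci-flat. -/
def LocallyConformallyRicciFlat (g : RiemannianMetric4 M) : Prop :=
  ∀ p : M, ∃ U : Set M, IsOpen U ∧ p ∈ U ∧ ∃ Ω : M → ℝ,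
    IsConformalFactorOn Ω U ∧ IsRicciFlatOn (conformalMetric Ω g) U

/-- The scalar `4 ∇^e C_{bcde} ∇_f C^{bcdf} - |V|² |C|²` of `g` vanishes on `M`. -/
def ScalarInvariantVanishes (g : RiemannianMetric4 M) : Prop :=
  ∀ e ∈ IsManifold.maximalAtlas (𝓡 4) ∞ M, ∀ y ∈ e.target,
    Coord.scalarInvariant (components g.inner e) y = 0

/-- The tensor `T_{ab}` of `g` vanishes on `M`. -/
def TensorTVanishes (g : RiemannianMetric4 M) : Prop :=
  ∀ e ∈ IsManifold.maximalAtlas (𝓡 4) ∞ M, ∀ y ∈ e.target, ∀ a b : Fin 4,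
    Coord.tensorT (components g.inner e) a b y = 0

/-- The tensor `T_{ab}` of `g` is conformally invariant: `Ω² g` has the same tensor `T_{ab}` as `g`,
for every smooth positive function `Ω` on an open subset of `M`. -/
def TensorTConformallyInvariant (g : RiemannianMetric4 M) : Prop :=
  ∀ (U : Set M) (Ω : M → ℝ), IsOpen U → IsConformalFactorOn Ω U →
    ∀ e ∈ IsManifold.maximalAtlas (𝓡 4) ∞ M, ∀ y ∈ e.target, e.symm y ∈ U → ∀ a b : Fin 4,
      Coord.tensorT (components (conformalMetric Ω g) e) a b y =
        Coord.tensorT (components g.inner e) a b y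

end Manifold

end

/-! Write `G' = exp (2 u) G` with `u = log Ω`. The Schouten tensor changes by `schoutenChange`,
while the lowered Weyl tensor is merely multiplied by `exp (2 u)`. Its divergence `∇^e C_{bcde}`
gains exactly `∇^m u C_{bcdm}`, with coefficient `n - 3 = 1` (`IsConformalOn.divWeyl_eq`). This
becomes a law for `V` through the four-dimensional identity `C^{bcd}{}_a C_{bcde} = ¼ |C|² g_{ae}`
(`IsMetricOn.weylUp_contract`). The identity holds because the Weyl tensor, as an operator on
two-forms, commutes with the Hodge star; so does its square, and the Ricci contraction of a
symmetric operator commuting with the star is pure trace. Below it is checked on components in an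
orthonormal frame. Hence `V` gains `du`, and in `T` the changes of `P`, `∇V`, `V ⊗ V` and `|V|² g`
cancel (`IsConformalOn.tensorT_eq`).

If `exp (2 u) g` is Ricci-flat, the contracted second Bianchi identity makes its Weyl tensor
divergence-free, so its `V` and its `T` vanish, and `T = 0` for `g` by invariance. Moreover `V =
-du` and `∇^e C_{bcde} = -∇^m u C_{bcdm}` for `g`, and the quadratic identity turns this into `4
|div C|² = |V|² |C|²`.

Conversely, every term of `T_{ab}` other than `∂_a V_b` is symmetric, so `T = 0` forces `dV = 0`. On
a ball in a chart the Poincaré lemma gives `V = -du`; the one-form of `exp (2 u) g` then vanishes,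
its `T` reduces to its Schouten tensor, and so the metric is Ricci-flat.

All these computations take place in a single chart. Since Ricci-flatness is required in every chart
while the potential `u` is built in one, the transformation law of the curvature under coordinate
changes is needed as well (`IsPullbackOn.ricci_eq_zero`). -/

noncomputable section

namespace Coord

/-! ### Partial derivatives in coordinates. -/

section Calculus
variable {f g : R4 → ℝ} {y : R4} {S : Set R4}

theorem pd_congr (a : Fin 4) (h : f =ᶠ[𝓝 y] g) : pd a f y = pd a g y := by
  unfold pd; rw [h.fderiv_eq]

theorem pd_congr_on (a : Fin 4) (hS : IsOpen S) (hy : y ∈ S) (h : ∀ z ∈ S, f z = g z) :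
    pd a f y = pd a g y :=
  pd_congr a (Filter.eventuallyEq_of_mem (hS.mem_nhds hy) h)

theorem pd_const (a : Fin 4) (c : ℝ) : pd a (fun _ => c) y = 0 := by
  simp [pd]

theorem pd_add (a : Fin 4) (hf : DifferentiableAt ℝ f y) (hg : DifferentiableAt ℝ g y) :
    pd a (fun z => f z + g z) y = pd a f y + pd a g y := by
  unfold pd; rw [fderiv_fun_add hf hg]; rfl

theorem pd_sub (a : Fin 4) (hf : DifferentiableAt ℝ f y) (hg : DifferentiableAt ℝ g y) :
    pd a (fun z => f z - g z) y = pd a f y - pd a g y := by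
  unfold pd; rw [fderiv_fun_sub hf hg]; rfl

theorem pd_neg (a : Fin 4) : pd a (fun z => - f z) y = - pd a f y := by
  unfold pd; rw [fderiv_fun_neg]; rfl

theorem pd_mul (a : Fin 4) (hf : DifferentiableAt ℝ f y) (hg : DifferentiableAt ℝ g y) :
    pd a (fun z => f z * g z) y = pd a f y * g y + f y * pd a g y := by
  unfold pd; rw [fderiv_fun_mul hf hg]; simp; ring

theorem pd_sum (a : Fin 4) {F : Fin 4 → R4 → ℝ} (hF : ∀ i, DifferentiableAt ℝ (F i) y) :
    pd a (fun z => ∑ i, F i z) y = ∑ i, pd a (F i) y := by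
  unfold pd; rw [fderiv_fun_sum fun i _ => hF i]; simp

theorem pd_exp_two_mul (a : Fin 4) (hf : DifferentiableAt ℝ f y) :
    pd a (fun z => Real.exp (2 * f z)) y = Real.exp (2 * f y) * (2 * pd a f y) := by
  unfold pd
  rw [fderiv_exp (by fun_prop), fderiv_const_mul hf]; simp

theorem contDiffOn_pd (a : Fin 4) (hS : IsOpen S) (hf : ContDiffOn ℝ ∞ f S) :
    ContDiffOn ℝ ∞ (pd a f) S :=
  (hf.fderiv_of_isOpen hS (by simp)).clm_apply contDiffOn_const

theorem _root_.ContDiffOn.differentiableAt_of_isOpen (hf : ContDiffOn ℝ ∞ f S) (hS : IsOpen S)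
    (hy : y ∈ S) : DifferentiableAt ℝ f y :=
  (hf.contDiffAt (hS.mem_nhds hy)).differentiableAt (by simp)

theorem pd_comm (a b : Fin 4) (hS : IsOpen S) (hf : ContDiffOn ℝ ∞ f S) (hy : y ∈ S) :
    pd a (pd b f) y = pd b (pd a f) y := by
  have hc := hf.contDiffAt (hS.mem_nhds hy)
  have hd : DifferentiableAt ℝ (fderiv ℝ f) y :=
    ((hf.fderiv_of_isOpen hS (m := ∞) (by simp)).contDiffAt (hS.mem_nhds hy)).differentiableAt
      (by simp)
  have h : ∀ a b, pd a (pd b f) y = fderiv ℝ (fderiv ℝ f) y (EuclideanSpace.single a (1 : ℝ))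
      (EuclideanSpace.single b (1 : ℝ)) := by
    intro a b
    unfold pd
    rw [fderiv_clm_apply hd (by fun_prop)]
    simp
  rw [h, h]
  exact (hc.isSymmSndFDerivAt (by
    rw [minSmoothness_of_isRCLikeNormedField]; exact WithTop.coe_le_coe.2 (le_top (a := (2 : ℕ∞))))).eq _ _

theorem fderiv_apply_eq_sum_pd (v : R4) : fderiv ℝ f y v = ∑ a, v a * pd a f y := by
  conv_lhs => rw [← (EuclideanSpace.basisFun (Fin 4) ℝ).sum_repr v]
  simp [pd]

end Calculus

/-! ### Metrics in coordinates: the inverse, raising and lowering, smoothness of the derived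
tensors. -/

/-- `G` is a smooth Riemannian metric on the open set `S` of coordinates. -/
structure IsMetricOn (G : MetricField) (S : Set R4) : Prop where
  isOpen : IsOpen S
  smooth : ∀ a b, ContDiffOn ℝ ∞ (fun y => G y a b) S
  symm : ∀ y ∈ S, ∀ a b, G y a b = G y b a
  posDef : ∀ y ∈ S, (G y).PosDef

namespace IsMetricOn
variable {G : MetricField} {S : Set R4} {y : R4} (hG : IsMetricOn G S)
include hG

theorem det_ne_zero (hy : y ∈ S) : (G y).det ≠ 0 := (hG.posDef y hy).det_pos.ne'

theorem sum_metric_inv (hy : y ∈ S) (a b : Fin 4) :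
    ∑ m, G y a m * invMetric G y m b = if a = b then 1 else 0 := by
  have h := Matrix.mul_nonsing_inv (G y) (hG.det_ne_zero hy).isUnit
  simpa [invMetric, Matrix.mul_apply, Matrix.one_apply] using congrFun (congrFun h a) b

theorem sum_inv_metric (hy : y ∈ S) (a b : Fin 4) :
    ∑ m, invMetric G y a m * G y m b = if a = b then 1 else 0 := by
  have h := Matrix.nonsing_inv_mul (G y) (hG.det_ne_zero hy).isUnit
  simpa [invMetric, Matrix.mul_apply, Matrix.one_apply] using congrFun (congrFun h a) b

theorem inv_symm (hy : y ∈ S) (a b : Fin 4) : invMetric G y a b = invMetric G y b a := by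
  have h : (G y).transpose = G y := by ext i j; exact hG.symm y hy j i
  unfold invMetric
  conv_lhs => rw [← h, ← Matrix.transpose_nonsing_inv]
  rfl

theorem lower_raise (hy : y ∈ S) (X : Fin 4 → ℝ) (c : Fin 4) :
    ∑ m, G y c m * ∑ d, invMetric G y m d * X d = X c := by
  simp_rw [Finset.mul_sum, ← mul_assoc]
  rw [Finset.sum_comm]
  simp_rw [← Finset.sum_mul, hG.sum_metric_inv hy]
  simp

theorem raise_lower (hy : y ∈ S) (X : Fin 4 → ℝ) (c : Fin 4) :
    ∑ m, invMetric G y c m * ∑ d, G y m d * X d = X c := by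
  simp_rw [Finset.mul_sum, ← mul_assoc]
  rw [Finset.sum_comm]
  simp_rw [← Finset.sum_mul, hG.sum_inv_metric hy]
  simp

theorem smooth_det : ContDiffOn ℝ ∞ (fun y => (G y).det) S := by
  have := hG.smooth
  simp only [Matrix.det_apply]
  fun_prop

/-- Cramer's rule: adjugate and determinant are polynomials in the entries of the metric, and the
determinant has no zero on `S`. -/
theorem smooth_inv (a b : Fin 4) : ContDiffOn ℝ ∞ (fun y => invMetric G y a b) S := by
  have hs := hG.smooth
  have h : ∀ y, invMetric G y a b = ((G y).det)⁻¹ * (G y).adjugate a b := by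
    intro y
    simp [invMetric, Matrix.inv_def]
  simp_rw [h, Matrix.adjugate_apply, Matrix.det_apply (Matrix.updateRow _ _ _)]
  refine ContDiffOn.mul (hG.smooth_det.inv fun y hy => hG.det_ne_zero hy) ?_
  simp only [Units.smul_def, zsmul_eq_mul]
  refine ContDiffOn.sum fun σ _ => contDiffOn_const.mul ?_
  refine contDiffOn_prod fun i _ => ?_
  simp only [Matrix.updateRow_apply]
  split_ifs
  · exact contDiffOn_const
  · exact hs _ _

theorem smooth_christoffel (c a b : Fin 4) : ContDiffOn ℝ ∞ (christoffel G c a b) S := by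
  have h1 := hG.smooth_inv
  have h2 := fun a b c => contDiffOn_pd a hG.isOpen (hG.smooth b c)
  unfold christoffel
  fun_prop

theorem smooth_curvature (a b c d : Fin 4) : ContDiffOn ℝ ∞ (curvature G a b c d) S := by
  have h1 := hG.smooth_christoffel
  have h2 := fun f a b c => contDiffOn_pd f hG.isOpen (h1 a b c)
  unfold curvature
  fun_prop

theorem smooth_riemann (a b c d : Fin 4) : ContDiffOn ℝ ∞ (riemann G a b c d) S := by
  have h1 := hG.smooth_curvature
  have h2 := hG.smooth
  unfold riemann
  fun_prop

theorem smooth_ricci (a b : Fin 4) : ContDiffOn ℝ ∞ (ricci G a b) S := by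
  have h1 := hG.smooth_curvature
  unfold ricci
  fun_prop

theorem smooth_schouten (a b : Fin 4) : ContDiffOn ℝ ∞ (schouten G a b) S := by
  have h1 := hG.smooth_ricci
  have h2 := hG.smooth
  have h3 := hG.smooth_inv
  unfold schouten scalarCurv
  fun_prop

theorem smooth_weyl (a b c d : Fin 4) : ContDiffOn ℝ ∞ (weyl G a b c d) S := by
  have h1 := hG.smooth_riemann
  have h2 := hG.smooth
  have h3 := hG.smooth_schouten
  unfold weyl
  fun_prop

theorem smooth_divWeyl (b c d : Fin 4) : ContDiffOn ℝ ∞ (divWeyl G b c d) S := by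
  have h1 := hG.smooth_weyl
  have h2 := fun f a b c d => contDiffOn_pd f hG.isOpen (h1 a b c d)
  have h3 := hG.smooth_inv
  have h4 := hG.smooth_christoffel
  unfold divWeyl nablaWeyl
  fun_prop

theorem smooth_weylUp (b c d a : Fin 4) : ContDiffOn ℝ ∞ (weylUp G b c d a) S := by
  have h1 := hG.smooth_weyl
  have h3 := hG.smooth_inv
  unfold weylUp
  fun_prop

theorem smooth_weylNormSq : ContDiffOn ℝ ∞ (weylNormSq G) S := by
  have h1 := hG.smooth_weyl
  have h3 := hG.smooth_inv
  have h4 := hG.smooth_weylUp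
  unfold weylNormSq
  fun_prop

theorem smooth_oneFormV (h : ∀ y ∈ S, weylNormSq G y ≠ 0) (a : Fin 4) :
    ContDiffOn ℝ ∞ (oneFormV G a) S := by
  have h1 := hG.smooth_divWeyl
  have h3 := hG.smooth_weylUp
  have h4 := hG.smooth_weylNormSq
  unfold oneFormV
  refine ContDiffOn.mul (contDiffOn_const.div h4 h) ?_
  fun_prop

end IsMetricOn
-- Algebraic symmetries of the Riemann and Weyl tensors.
namespace IsMetricOn
variable {G : MetricField} {S : Set R4} {y : R4} (hG : IsMetricOn G S)
include hG

theorem pd_metric_symm (hy : y ∈ S) (a b c : Fin 4) :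
    pd a (fun z => G z b c) y = pd a (fun z => G z c b) y :=
  pd_congr_on a hG.isOpen hy fun z hz => hG.symm z hz b c

theorem christoffel_symm (hy : y ∈ S) (c a b : Fin 4) :
    christoffel G c a b y = christoffel G c b a y := by
  unfold christoffel
  simp_rw [hG.pd_metric_symm hy _ a b]
  congr 1
  refine Finset.sum_congr rfl fun d _ => ?_
  ring

theorem lower_christoffel (hy : y ∈ S) (c a b : Fin 4) :
    ∑ m, G y c m * christoffel G m a b y =
      (1 / 2) * (pd a (fun z => G z b c) y + pd b (fun z => G z a c) y
        - pd c (fun z => G z a b) y) := by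
  unfold christoffel
  simp_rw [mul_left_comm _ (1 / 2 : ℝ)]
  rw [← Finset.mul_sum, hG.lower_raise hy
    (fun d => pd a (fun z => G z b d) y + pd b (fun z => G z a d) y - pd d (fun z => G z a b) y)]

theorem pd_metric (hy : y ∈ S) (a b c : Fin 4) :
    pd a (fun z => G z b c) y =
      ∑ m, (G y c m * christoffel G m a b y + G y b m * christoffel G m a c y) := by
  rw [Finset.sum_add_distrib, hG.lower_christoffel hy, hG.lower_christoffel hy,
    hG.pd_metric_symm hy a c b, hG.pd_metric_symm hy b a c, hG.pd_metric_symm hy c a b,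
    hG.pd_metric_symm hy b c a]
  ring

/-- Metric compatibility used twice: the first derivatives of `G` that appear on differentiating
`pd_metric` are again written with Christoffel symbols. -/
theorem pd_pd_metric (hy : y ∈ S) (a b c d : Fin 4) :
    pd a (pd b (fun z => G z c d)) y =
      ∑ m, ((∑ n, (G y m n * christoffel G n a d y + G y d n * christoffel G n a m y))
            * christoffel G m b c y + G y d m * pd a (christoffel G m b c) y
          + ((∑ n, (G y m n * christoffel G n a c y + G y c n * christoffel G n a m y))
            * christoffel G m b d y + G y c m * pd a (christoffel G m b d) y)) := by
  have h1 : ∀ a b, DifferentiableAt ℝ (fun y => G y a b) y := fun a b =>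
    (hG.smooth a b).differentiableAt_of_isOpen hG.isOpen hy
  have h2 : ∀ c a b, DifferentiableAt ℝ (christoffel G c a b) y := fun c a b =>
    (hG.smooth_christoffel c a b).differentiableAt_of_isOpen hG.isOpen hy
  rw [pd_congr_on a hG.isOpen hy fun _ hz => hG.pd_metric hz b c d, pd_sum a (by fun_prop)]
  refine Finset.sum_congr rfl fun m _ => ?_
  rw [pd_add a (by fun_prop) (by fun_prop), pd_mul a (h1 _ _) (h2 _ _ _),
    pd_mul a (h1 _ _) (h2 _ _ _), hG.pd_metric hy a d m, hG.pd_metric hy a c m]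

/-- Since `∇G = 0`, the commutator of two covariant derivatives annihilates `G`. In coordinates this
is the equality of the mixed second derivatives of `G_{cd}`. -/
theorem riemann_antisymm_right (hy : y ∈ S) (a b c d : Fin 4) :
    riemann G a b c d y = - riemann G a b d c y := by
  have E := pd_comm a b hG.isOpen (hG.smooth c d) hy
  rw [hG.pd_pd_metric hy, hG.pd_pd_metric hy] at E
  unfold riemann curvature
  have s := hG.symm y hy
  simp only [Fin.sum_univ_four] at E ⊢
  rw [s 1 0, s 2 0, s 3 0, s 2 1, s 3 1, s 3 2] at E
  linear_combination E

omit hG in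
theorem curvature_antisymm (a b c d : Fin 4) : curvature G a b c d y = - curvature G b a c d y := by
  unfold curvature
  simp only [Fin.sum_univ_four]
  ring

omit hG in
theorem riemann_antisymm_left (a b c d : Fin 4) : riemann G a b c d y = - riemann G b a c d y := by
  unfold riemann
  simp_rw [curvature_antisymm a b, mul_neg, Finset.sum_neg_distrib]

theorem pd_christoffel_symm (hy : y ∈ S) (e c a b : Fin 4) :
    pd e (christoffel G c a b) y = pd e (christoffel G c b a) y :=
  pd_congr_on e hG.isOpen hy fun _ hz => hG.christoffel_symm hz c a b

/-- First Bianchi identity: the connection is torsion-free, and with symmetric Christoffel symbols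
all terms cancel in pairs. -/
theorem curvature_cyclic (hy : y ∈ S) (a b c d : Fin 4) :
    curvature G a b c d y + curvature G b d c a y + curvature G d a c b y = 0 := by
  unfold curvature
  rw [hG.pd_christoffel_symm hy a c d b, hG.pd_christoffel_symm hy b c d a,
    hG.pd_christoffel_symm hy d c b a]
  simp_rw [hG.christoffel_symm hy _ d b, hG.christoffel_symm hy _ d a, hG.christoffel_symm hy _ b a]
  simp only [Fin.sum_univ_four]
  ring

theorem riemann_cyclic (hy : y ∈ S) (a b c d : Fin 4) :
    riemann G a b c d y + riemann G b d c a y + riemann G d a c b y = 0 := by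
  unfold riemann
  simp_rw [← Finset.sum_add_distrib, ← mul_add, hG.curvature_cyclic hy]
  simp

/-- The classical octahedron argument: four instances of the cyclic identity are combined, and the
remaining terms cancel by the two antisymmetries. -/
theorem riemann_pair_symm (hy : y ∈ S) (a b c d : Fin 4) :
    riemann G a b c d y = riemann G c d a b y := by
  have h1 := hG.riemann_cyclic hy a b c d
  have h2 := hG.riemann_cyclic hy b c d a
  have h3 := hG.riemann_cyclic hy c d a b
  have h4 := hG.riemann_cyclic hy d a b c
  have r := hG.riemann_antisymm_right hy
  have l := riemann_antisymm_left (G := G) (y := y)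
  linarith [r a b c d, r b d c a, r d a c b, r b c d a, r c a d b, r a b d c, r c d a b, r d b a c,
    r b c a d, r d a b c, r a c b d, r c d b a, l a b c d, l b d c a, l d a c b, l b c d a, l c a d b,
    l a b d c, l c d a b, l d b a c, l b c a d, l d a b c, l a c b d, l c d b a,
    l b d a c, l a c d b, l c a b d, l d b c a]

theorem curvature_eq_sum_riemann (hy : y ∈ S) (a b c d : Fin 4) :
    curvature G a b c d y = ∑ m, invMetric G y c m * riemann G a b m d y := by
  unfold riemann
  exact (hG.raise_lower hy (fun m => curvature G a b m d y) c).symm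

theorem ricci_eq_sum_riemann (hy : y ∈ S) (b d : Fin 4) :
    ricci G b d y = ∑ a, ∑ c, invMetric G y a c * riemann G a b c d y := by
  unfold ricci
  simp_rw [hG.curvature_eq_sum_riemann hy]

theorem ricci_symm (hy : y ∈ S) (b d : Fin 4) : ricci G b d y = ricci G d b y := by
  rw [hG.ricci_eq_sum_riemann hy, hG.ricci_eq_sum_riemann hy, Finset.sum_comm]
  refine Finset.sum_congr rfl fun a _ => Finset.sum_congr rfl fun c _ => ?_
  rw [hG.inv_symm hy, hG.riemann_pair_symm hy c b]

theorem schouten_symm (hy : y ∈ S) (b d : Fin 4) : schouten G b d y = schouten G d b y := by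
  unfold schouten
  rw [hG.ricci_symm hy, hG.symm y hy b d]

theorem weyl_antisymm_right (hy : y ∈ S) (a b c d : Fin 4) :
    weyl G a b c d y = - weyl G a b d c y := by
  unfold weyl
  rw [hG.riemann_antisymm_right hy]
  ring

omit hG in
theorem weyl_antisymm_left (a b c d : Fin 4) : weyl G a b c d y = - weyl G b a c d y := by
  unfold weyl
  rw [riemann_antisymm_left]
  ring

theorem weyl_pair_symm (hy : y ∈ S) (a b c d : Fin 4) :
    weyl G a b c d y = weyl G c d a b y := by
  unfold weyl
  rw [hG.riemann_pair_symm hy, hG.symm y hy c a, hG.symm y hy c b, hG.symm y hy d a,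
    hG.symm y hy d b, hG.schouten_symm hy c a, hG.schouten_symm hy c b, hG.schouten_symm hy d a,
    hG.schouten_symm hy d b]
  ring

theorem weyl_cyclic (hy : y ∈ S) (a b c d : Fin 4) :
    weyl G a b c d y + weyl G b d c a y + weyl G d a c b y = 0 := by
  have h := hG.riemann_cyclic hy a b c d
  unfold weyl
  rw [hG.symm y hy b a, hG.symm y hy d a, hG.symm y hy d b, hG.schouten_symm hy b a,
    hG.schouten_symm hy d a, hG.schouten_symm hy d b]
  linear_combination h

theorem trace_metric (hy : y ∈ S) : ∑ a, ∑ c, invMetric G y a c * G y a c = 4 := by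
  have h : ∀ a, ∑ c, invMetric G y a c * G y a c = 1 := fun a => by
    simpa [hG.symm y hy a] using hG.sum_inv_metric hy a a
  simp_rw [h]
  simp

theorem trace_metric_left (hy : y ∈ S) (X : Fin 4 → ℝ) (d : Fin 4) :
    ∑ a, ∑ c, invMetric G y a c * (G y a d * X c) = X d := by
  have h : ∀ a c, invMetric G y a c * (G y a d * X c) = invMetric G y c a * G y a d * X c :=
    fun a c => by rw [hG.inv_symm hy a c]; ring
  rw [Finset.sum_comm]
  simp_rw [h, ← Finset.sum_mul, hG.sum_inv_metric hy]
  simp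

theorem trace_metric_right (hy : y ∈ S) (X : Fin 4 → ℝ) (b : Fin 4) :
    ∑ a, ∑ c, invMetric G y a c * (G y b c * X a) = X b := by
  have h : ∀ c, G y b c = G y c b := hG.symm y hy b
  simp_rw [← mul_assoc, ← Finset.sum_mul, h, hG.sum_inv_metric hy]
  simp

/-- The trace over the first and third indices of a Kulkarni–Nomizu product with the metric. -/
theorem trace_kulkarniNomizu (hy : y ∈ S) (Q : Fin 4 → Fin 4 → ℝ) (b d : Fin 4) :
    ∑ a, ∑ c, invMetric G y a c *
      (G y a c * Q b d - G y a d * Q b c + G y b d * Q a c - G y b c * Q a d) =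
      2 * Q b d + G y b d * ∑ a, ∑ c, invMetric G y a c * Q a c := by
  have h1 := hG.trace_metric hy
  have h2 := hG.trace_metric_left hy (fun c => Q b c) d
  have h3 := hG.trace_metric_right hy (fun a => Q a d) b
  have e : ∑ a, ∑ c, invMetric G y a c *
      (G y a c * Q b d - G y a d * Q b c + G y b d * Q a c - G y b c * Q a d) =
      (∑ a, ∑ c, invMetric G y a c * G y a c) * Q b d
      - ∑ a, ∑ c, invMetric G y a c * (G y a d * Q b c)
      + G y b d * ∑ a, ∑ c, invMetric G y a c * Q a c
      - ∑ a, ∑ c, invMetric G y a c * (G y b c * Q a d) := by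
    simp_rw [Finset.sum_mul, Finset.mul_sum, ← Finset.sum_sub_distrib, ← Finset.sum_add_distrib,
      ← Finset.sum_sub_distrib]
    refine Finset.sum_congr rfl fun a _ => Finset.sum_congr rfl fun c _ => ?_
    ring
  rw [e, h1, h2, h3]
  ring

theorem trace_schouten (hy : y ∈ S) :
    ∑ a, ∑ c, invMetric G y a c * schouten G a c y = (1 / 6) * scalarCurv G y := by
  have e : ∑ a, ∑ c, invMetric G y a c * schouten G a c y = (1 / 2) * scalarCurv G y
      - (1 / 12) * scalarCurv G y * ∑ a, ∑ c, invMetric G y a c * G y a c := by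
    conv_rhs => enter [1]; unfold scalarCurv
    unfold schouten
    simp_rw [Finset.mul_sum, ← Finset.sum_sub_distrib]
    refine Finset.sum_congr rfl fun a _ => Finset.sum_congr rfl fun c _ => ?_
    ring
  rw [e, hG.trace_metric hy]
  ring

/-- The Schouten tensor is the solution of `2 P + (tr P) G = Ric`, so the Kulkarni–Nomizu term
subtracted from the Riemann tensor has exactly its Ricci trace. -/
theorem weyl_trace (hy : y ∈ S) (b d : Fin 4) :
    ∑ a, ∑ c, invMetric G y a c * weyl G a b c d y = 0 := by
  unfold weyl
  simp_rw [mul_sub (invMetric G y _ _) (riemann _ _ _ _ _ _), Finset.sum_sub_distrib]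
  rw [hG.trace_kulkarniNomizu hy (fun a b => schouten G a b y), ← hG.ricci_eq_sum_riemann hy,
    hG.trace_schouten hy]
  unfold schouten
  ring

end IsMetricOn

/-! ### The second Bianchi identity and the Weyl divergence of a Ricci-flat metric. -/

/-- The covariant derivative `(∇_f R)_{ab}{}^c{}_d` of the curvature. -/
def nablaCurvature (G : MetricField) (f a b c d : Fin 4) (y : R4) : ℝ :=
  pd f (curvature G a b c d) y
    + ∑ n, (christoffel G c f n y * curvature G a b n d y
      - christoffel G n f d y * curvature G a b c n y
      - christoffel G n f a y * curvature G n b c d y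
      - christoffel G n f b y * curvature G a n c d y)

namespace IsMetricOn
variable {G : MetricField} {S : Set R4} {y : R4} (hG : IsMetricOn G S)
include hG

theorem pd_curvature (hy : y ∈ S) (f a b c d : Fin 4) :
    pd f (curvature G a b c d) y =
      pd f (pd a (christoffel G c b d)) y - pd f (pd b (christoffel G c a d)) y
      + ∑ m, (pd f (christoffel G c a m) y * christoffel G m b d y
        + christoffel G c a m y * pd f (christoffel G m b d) y
        - pd f (christoffel G c b m) y * christoffel G m a d y
        - christoffel G c b m y * pd f (christoffel G m a d) y) := by
  have h1 : ∀ c a b, DifferentiableAt ℝ (christoffel G c a b) y := fun c a b =>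
    (hG.smooth_christoffel c a b).differentiableAt_of_isOpen hG.isOpen hy
  have h2 : ∀ e c a b, DifferentiableAt ℝ (pd e (christoffel G c a b)) y := fun e c a b =>
    (contDiffOn_pd e hG.isOpen (hG.smooth_christoffel c a b)).differentiableAt_of_isOpen hG.isOpen hy
  unfold curvature
  rw [pd_add f (by fun_prop) (by fun_prop), pd_sub f (h2 _ _ _ _) (h2 _ _ _ _),
    pd_sum f (by fun_prop)]
  congr 1
  refine Finset.sum_congr rfl fun m _ => ?_
  rw [pd_sub f (by fun_prop) (by fun_prop), pd_mul f (h1 _ _ _) (h1 _ _ _),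
    pd_mul f (h1 _ _ _) (h1 _ _ _)]
  ring

/-- Second Bianchi identity: the second derivatives of the Christoffel symbols cancel because
partial derivatives commute, the rest because the connection is torsion-free. -/
theorem nablaCurvature_cyclic (hy : y ∈ S) (f a b c d : Fin 4) :
    nablaCurvature G f a b c d y + nablaCurvature G a b f c d y + nablaCurvature G b f a c d y
      = 0 := by
  unfold nablaCurvature
  rw [hG.pd_curvature hy, hG.pd_curvature hy, hG.pd_curvature hy,
    pd_comm a f hG.isOpen (hG.smooth_christoffel c b d) hy,
    pd_comm b f hG.isOpen (hG.smooth_christoffel c a d) hy,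
    pd_comm b a hG.isOpen (hG.smooth_christoffel c f d) hy]
  simp_rw [hG.christoffel_symm hy _ a f, hG.christoffel_symm hy _ b f,
    hG.christoffel_symm hy _ b a]
  -- The summed index is moved to the second slot, so that the corrections in the two form indices
  -- cancel between the three cyclic terms.
  have q := fun n => curvature_antisymm (G := G) (y := y) n
  simp_rw [fun n => q n a c d, fun n => q n b c d, fun n => q n f c d]
  unfold curvature
  simp only [Fin.sum_univ_four]
  ring

omit hG in
theorem nablaCurvature_antisymm (f a b c d : Fin 4) :
    nablaCurvature G f a b c d y = - nablaCurvature G f b a c d y := by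
  have h : curvature G a b c d = fun y => - curvature G b a c d y :=
    funext fun y => curvature_antisymm a b c d
  unfold nablaCurvature
  rw [h, pd_neg]
  have q := curvature_antisymm (G := G) (y := y)
  simp_rw [fun n => q a b n d, fun n => q a b c n, fun n => q n b c d, fun n => q a n c d]
  simp only [Fin.sum_univ_four]
  ring

/-- Contracting an upper with a lower index commutes with `∇`, so this trace is `∇_a Ric_{bd}`. The
corrections on the contracted pair cancel; those on `b` and `d` multiply components of the Ricci
tensor. -/
theorem trace_nablaCurvature_of_ricci_eq_zero (hR : ∀ z ∈ S, ∀ a b, ricci G a b z = 0) (hy : y ∈ S)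
    (a b d : Fin 4) : ∑ f, nablaCurvature G a f b f d y = 0 := by
  have h1 : ∀ a b c d, DifferentiableAt ℝ (curvature G a b c d) y := fun a b c d =>
    (hG.smooth_curvature a b c d).differentiableAt_of_isOpen hG.isOpen hy
  have h2 : ∑ f, pd a (curvature G f b f d) y = 0 := by
    rw [← pd_sum a fun f => h1 f b f d, ← pd_const (y := y) a 0]
    exact pd_congr_on a hG.isOpen hy fun z hz => hR z hz b d
  have h3 := fun b d => hR y hy b d
  unfold ricci at h3
  unfold nablaCurvature
  simp only [Fin.sum_univ_four] at h2 h3 ⊢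
  linear_combination h2 - christoffel G 0 a d y * h3 b 0 - christoffel G 1 a d y * h3 b 1
    - christoffel G 2 a d y * h3 b 2 - christoffel G 3 a d y * h3 b 3
    - christoffel G 0 a b y * h3 0 d - christoffel G 1 a b y * h3 1 d
    - christoffel G 2 a b y * h3 2 d - christoffel G 3 a b y * h3 3 d

/-- Contracted Bianchi identity: the divergence of the curvature is the antisymmetrised derivative
`∇_a Ric_{bd} - ∇_b Ric_{ad}`. -/
theorem div_curvature_of_ricci_eq_zero (hR : ∀ z ∈ S, ∀ a b, ricci G a b z = 0) (hy : y ∈ S)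
    (a b d : Fin 4) : ∑ f, nablaCurvature G f a b f d y = 0 := by
  have h : ∀ f, nablaCurvature G f a b f d y =
      nablaCurvature G a f b f d y - nablaCurvature G b f a f d y := fun f => by
    have := hG.nablaCurvature_cyclic hy f a b f d
    rw [nablaCurvature_antisymm a b f] at this
    linear_combination this
  simp_rw [h, Finset.sum_sub_distrib, hG.trace_nablaCurvature_of_ricci_eq_zero hR hy]
  simp

omit hG in
theorem weyl_eq_riemann_of_ricci_eq_zero (hR : ∀ z ∈ S, ∀ a b, ricci G a b z = 0) (hy : y ∈ S)
    (a b c d : Fin 4) : weyl G a b c d y = riemann G a b c d y := by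
  have h : ∀ a b, schouten G a b y = 0 := fun a b => by simp [schouten, scalarCurv, hR y hy]
  simp [weyl, h]

/-- Here the Weyl tensor is the Riemann tensor, and lowering an index commutes with `∇` by metric
compatibility. -/
theorem nablaWeyl_eq_of_ricci_eq_zero (hR : ∀ z ∈ S, ∀ a b, ricci G a b z = 0) (hy : y ∈ S)
    (f a b c d : Fin 4) :
    nablaWeyl G f a b c d y = ∑ m, G y c m * nablaCurvature G f a b m d y := by
  have h0 : ∀ a b, DifferentiableAt ℝ (fun y => G y a b) y := fun a b =>
    (hG.smooth a b).differentiableAt_of_isOpen hG.isOpen hy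
  have h1 : ∀ a b c d, DifferentiableAt ℝ (curvature G a b c d) y := fun a b c d =>
    (hG.smooth_curvature a b c d).differentiableAt_of_isOpen hG.isOpen hy
  have h2 : pd f (weyl G a b c d) y =
      ∑ m, ((∑ n, (G y m n * christoffel G n f c y + G y c n * christoffel G n f m y))
        * curvature G a b m d y + G y c m * pd f (curvature G a b m d) y) := by
    rw [pd_congr_on f hG.isOpen hy fun z hz => weyl_eq_riemann_of_ricci_eq_zero hR hz a b c d]
    unfold riemann
    rw [pd_sum f (by fun_prop)]
    refine Finset.sum_congr rfl fun m _ => ?_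
    rw [pd_mul f (h0 _ _) (h1 _ _ _ _), hG.pd_metric hy f c m]
  unfold nablaWeyl
  rw [h2]
  simp_rw [weyl_eq_riemann_of_ricci_eq_zero hR hy]
  unfold riemann nablaCurvature
  have s := hG.symm y hy
  simp only [Fin.sum_univ_four]
  rw [s 1 0, s 2 0, s 3 0, s 2 1, s 3 1, s 3 2]
  ring

theorem nablaWeyl_antisymm_right (hy : y ∈ S) (f a b c d : Fin 4) :
    nablaWeyl G f a b c d y = - nablaWeyl G f a b d c y := by
  have h : pd f (weyl G a b c d) y = - pd f (weyl G a b d c) y := by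
    rw [← pd_neg]
    exact pd_congr_on f hG.isOpen hy fun z hz => hG.weyl_antisymm_right hz a b c d
  unfold nablaWeyl
  rw [h]
  have q := hG.weyl_antisymm_right hy
  simp_rw [fun m => q m b c d, fun m => q a m c d, fun m => q a b m d, fun m => q a b c m]
  simp only [Fin.sum_univ_four]
  ring

theorem divWeyl_of_ricci_eq_zero (hR : ∀ z ∈ S, ∀ a b, ricci G a b z = 0) (hy : y ∈ S)
    (b c d : Fin 4) : divWeyl G b c d y = 0 := by
  unfold divWeyl
  -- Antisymmetry brings the contracted index to the third slot, which is the upper index of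
  -- `nablaCurvature`.
  simp_rw [hG.nablaWeyl_antisymm_right hy _ b c d, hG.nablaWeyl_eq_of_ricci_eq_zero hR hy]
  rw [Finset.sum_comm]
  have h : ∀ f, ∑ e, invMetric G y e f * -∑ m, G y e m * nablaCurvature G f b c m d y =
      - nablaCurvature G f b c f d y := fun f => by
    rw [← hG.raise_lower hy (fun m => nablaCurvature G f b c m d y) f, ← Finset.sum_neg_distrib]
    refine Finset.sum_congr rfl fun e _ => ?_
    rw [hG.inv_symm hy e f]
    ring
  simp_rw [h, Finset.sum_neg_distrib, hG.div_curvature_of_ricci_eq_zero hR hy, neg_zero]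

end IsMetricOn

/-! ### Conformal change of the connection and of the Riemann tensor. -/

/-- The gradient `∇^c u` of a function. -/
def gradient (G : MetricField) (u : R4 → ℝ) (c : Fin 4) (y : R4) : ℝ :=
  ∑ k, invMetric G y c k * pd k u y

/-- The change `-∇_a ∇_b u + ∇_a u ∇_b u - ½ |∇u|² G_{ab}` of the Schouten tensor under
`G ↦ exp (2 u) G`. -/
def schoutenChange (G : MetricField) (u : R4 → ℝ) (a b : Fin 4) (y : R4) : ℝ :=
  -(pd a (pd b u) y - ∑ m, christoffel G m a b y * pd m u y) + pd a u y * pd b u y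
    - (1 / 2) * (∑ m, gradient G u m y * pd m u y) * G y a b

/-- On the open set `S`, the field `G'` is the conformal rescaling `exp (2 u) G` of the
metric `G`. -/
structure IsConformalOn (G G' : MetricField) (u : R4 → ℝ) (S : Set R4) : Prop where
  metric : IsMetricOn G S
  smooth : ContDiffOn ℝ ∞ u S
  eq : ∀ y ∈ S, ∀ a b, G' y a b = Real.exp (2 * u y) * G y a b

namespace IsConformalOn
variable {G G' : MetricField} {u : R4 → ℝ} {S : Set R4} {y : R4} (h : IsConformalOn G G' u S)
include h

theorem eq_smul (hy : y ∈ S) : G' y = Real.exp (2 * u y) • G y := by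
  ext a b; simpa using h.eq y hy a b

theorem metric' : IsMetricOn G' S where
  isOpen := h.metric.isOpen
  smooth a b := by
    have h1 := h.metric.smooth a b
    have h2 := h.smooth
    exact ContDiffOn.congr (f := fun y => Real.exp (2 * u y) * G y a b) (by fun_prop)
      fun y hy => h.eq y hy a b
  symm y hy a b := by rw [h.eq y hy, h.eq y hy, h.metric.symm y hy]
  posDef y hy := by
    rw [h.eq_smul hy]
    exact (h.metric.posDef y hy).smul (Real.exp_pos _)

theorem invMetric_eq (hy : y ∈ S) (a b : Fin 4) :
    invMetric G' y a b = (Real.exp (2 * u y))⁻¹ * invMetric G y a b := by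
  unfold invMetric
  rw [h.eq_smul hy]
  have := Matrix.inv_smul' (A := G y) (Units.mk0 _ (Real.exp_ne_zero (2 * u y)))
    (h.metric.det_ne_zero hy).isUnit
  simpa [Units.smul_def] using congrFun (congrFun this a) b

theorem differentiableAt_potential (hy : y ∈ S) : DifferentiableAt ℝ u y :=
  h.smooth.differentiableAt_of_isOpen h.metric.isOpen hy

theorem smooth_pd (a : Fin 4) : ContDiffOn ℝ ∞ (pd a u) S :=
  contDiffOn_pd a h.metric.isOpen h.smooth

theorem smooth_gradient (a : Fin 4) : ContDiffOn ℝ ∞ (gradient G u a) S := by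
  have h1 := h.metric.smooth_inv
  have h2 := h.smooth_pd
  unfold gradient
  fun_prop

theorem lower_gradient (hy : y ∈ S) (c : Fin 4) :
    ∑ m, G y c m * gradient G u m y = pd c u y :=
  h.metric.lower_raise hy (fun k => pd k u y) c

theorem pd_metric' (hy : y ∈ S) (a b c : Fin 4) :
    pd a (fun z => G' z b c) y =
      Real.exp (2 * u y) * (2 * pd a u y * G y b c + pd a (fun z => G z b c) y) := by
  have h1 := h.differentiableAt_potential hy
  have h2 := (h.metric.smooth b c).differentiableAt_of_isOpen h.metric.isOpen hy
  rw [pd_congr_on a h.metric.isOpen hy fun z hz => h.eq z hz b c,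
    pd_mul a (by fun_prop) h2, pd_exp_two_mul a h1]
  ring

theorem christoffel_eq (hy : y ∈ S) (c a b : Fin 4) :
    christoffel G' c a b y = christoffel G c a b y + (if c = a then 1 else 0) * pd b u y
      + (if c = b then 1 else 0) * pd a u y - gradient G u c y * G y a b := by
  have hE := Real.exp_ne_zero (2 * u y)
  -- Writing the Kronecker deltas as `G⁻¹ G` puts both sides under one sum over `d`, to be compared
  -- term by term.
  rw [← h.metric.sum_inv_metric hy c a, ← h.metric.sum_inv_metric hy c b]
  unfold christoffel gradient
  simp_rw [h.invMetric_eq hy, h.pd_metric' hy, Finset.mul_sum, Finset.sum_mul]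
  rw [← Finset.sum_add_distrib, ← Finset.sum_add_distrib, ← Finset.sum_sub_distrib]
  refine Finset.sum_congr rfl fun d _ => ?_
  rw [h.metric.symm y hy d a, h.metric.symm y hy d b]
  field_simp
  ring

/-- Contraction with the upper index of the Christoffel symbols of the rescaled metric. -/
theorem sum_mul_christoffel (hy : y ∈ S) (X : Fin 4 → ℝ) (b d : Fin 4) :
    ∑ n, X n * christoffel G' n b d y = ∑ n, X n * christoffel G n b d y + X b * pd d u y
      + X d * pd b u y - (∑ n, X n * gradient G u n y) * G y b d := by
  simp_rw [h.christoffel_eq hy, mul_sub, mul_add, Finset.sum_sub_distrib, Finset.sum_add_distrib,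
    ← mul_assoc, ← Finset.sum_mul]
  simp

theorem sum_metric_mul_pd_gradient (hy : y ∈ S) (a c : Fin 4) :
    ∑ m, G y c m * pd a (gradient G u m) y =
      pd a (pd c u) y - ∑ m, pd a (fun z => G z c m) y * gradient G u m y := by
  have h1 : ∀ a b, DifferentiableAt ℝ (fun y => G y a b) y := fun a b =>
    (h.metric.smooth a b).differentiableAt_of_isOpen h.metric.isOpen hy
  have h2 : ∀ m, DifferentiableAt ℝ (gradient G u m) y := fun m =>
    (h.smooth_gradient m).differentiableAt_of_isOpen h.metric.isOpen hy
  rw [← pd_congr_on a h.metric.isOpen hy fun z hz => h.lower_gradient hz c, pd_sum a (by fun_prop),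
    ← Finset.sum_sub_distrib]
  refine Finset.sum_congr rfl fun m _ => ?_
  rw [pd_mul a (h1 _ _) (h2 _)]
  ring

theorem pd_christoffel_eq (hy : y ∈ S) (e c a b : Fin 4) :
    pd e (christoffel G' c a b) y = pd e (christoffel G c a b) y
      + (if c = a then 1 else 0) * pd e (pd b u) y + (if c = b then 1 else 0) * pd e (pd a u) y
      - (pd e (gradient G u c) y * G y a b + gradient G u c y * pd e (fun z => G z a b) y) := by
  have h1 : ∀ a b, DifferentiableAt ℝ (fun y => G y a b) y := fun a b =>
    (h.metric.smooth a b).differentiableAt_of_isOpen h.metric.isOpen hy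
  have h2 : ∀ m, DifferentiableAt ℝ (gradient G u m) y := fun m =>
    (h.smooth_gradient m).differentiableAt_of_isOpen h.metric.isOpen hy
  have h3 : ∀ m, DifferentiableAt ℝ (pd m u) y := fun m =>
    (h.smooth_pd m).differentiableAt_of_isOpen h.metric.isOpen hy
  have h4 : ∀ c a b, DifferentiableAt ℝ (christoffel G c a b) y := fun c a b =>
    (h.metric.smooth_christoffel c a b).differentiableAt_of_isOpen h.metric.isOpen hy
  rw [pd_congr_on e h.metric.isOpen hy fun z hz => h.christoffel_eq hz c a b,
    pd_sub e (by fun_prop) (by fun_prop), pd_add e (by fun_prop) (by fun_prop),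
    pd_add e (by fun_prop) (by fun_prop), pd_mul e (by fun_prop) (h3 _),
    pd_mul e (by fun_prop) (h3 _), pd_mul e (h2 _) (h1 _ _), pd_const, pd_const]
  ring

theorem sum_metric_mul_pd_christoffel (hy : y ∈ S) (a b c d : Fin 4) :
    ∑ m, G y c m * pd a (christoffel G' m b d) y =
      ∑ m, G y c m * pd a (christoffel G m b d) y + G y c b * pd a (pd d u) y
      + G y c d * pd a (pd b u) y
      - ((pd a (pd c u) y - ∑ m, pd a (fun z => G z c m) y * gradient G u m y) * G y b d
        + pd c u y * pd a (fun z => G z b d) y) := by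
  rw [← h.sum_metric_mul_pd_gradient hy, ← h.lower_gradient hy c]
  simp_rw [h.pd_christoffel_eq hy, mul_sub, mul_add, Finset.sum_sub_distrib,
    Finset.sum_add_distrib, ← mul_assoc, ← Finset.sum_mul]
  simp

/-- Everything is lowered with `G`. The lowered symbols `L`, the contraction `N` of the Christoffel
symbols with `du` and the number `s = |∇u|²` are made opaque, and derivatives of `G` are rewritten
through `L`. The terms beyond the Riemann tensor of `G` are then polynomial in these, in `G` and in
the derivatives of `u`, and they assemble into the Kulkarni–Nomizu product of `G` with
`schoutenChange`. -/
theorem riemann_eq (hy : y ∈ S) (a b c d : Fin 4) :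
    riemann G' a b c d y = Real.exp (2 * u y) * (riemann G a b c d y
      + (G y a c * schoutenChange G u b d y - G y a d * schoutenChange G u b c y
        + G y b d * schoutenChange G u a c y - G y b c * schoutenChange G u a d y)) := by
  obtain ⟨L, hL⟩ : ∃ L : Fin 4 → Fin 4 → Fin 4 → ℝ,
      ∀ c a b, ∑ m, G y c m * christoffel G m a b y = L c a b := ⟨_, fun _ _ _ => rfl⟩
  have hs := h.metric.symm y hy
  have hLs : ∀ c a b, L c a b = L c b a := fun c a b => by
    simp_rw [← hL, h.metric.christoffel_symm hy _ a b]
  have hL' : ∀ c a b, ∑ m, G y c m * christoffel G' m a b y =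
      L c a b + G y c a * pd b u y + G y c b * pd a u y - pd c u y * G y a b := fun c a b => by
    rw [h.sum_mul_christoffel hy, h.lower_gradient hy, hL]
  have hg : ∀ a b c, pd a (fun z => G z b c) y = L c a b + L b a c := fun a b c => by
    rw [h.metric.pd_metric hy, Finset.sum_add_distrib, hL, hL]
  obtain ⟨N, hN⟩ : ∃ N : Fin 4 → Fin 4 → ℝ,
      ∀ a b, ∑ m, christoffel G m a b y * pd m u y = N a b := ⟨_, fun _ _ => rfl⟩
  have hNs : ∀ a b, N a b = N b a := fun a b => by
    simp_rw [← hN, h.metric.christoffel_symm hy _ a b]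
  have hN' : ∀ a b, ∑ m, pd m u y * christoffel G m a b y = N a b := fun a b => by
    simp_rw [← hN, mul_comm]
  have hLU : ∀ a c, ∑ m, L m a c * gradient G u m y = N a c := fun a c => by
    simp_rw [← hN, ← h.lower_gradient hy, ← hL, Finset.sum_mul, Finset.mul_sum]
    rw [Finset.sum_comm]
    refine Finset.sum_congr rfl fun m _ => Finset.sum_congr rfl fun n _ => ?_
    rw [hs]; ring
  obtain ⟨s, hS⟩ : ∃ s, ∑ m, gradient G u m y * pd m u y = s := ⟨_, rfl⟩
  have hS' : ∑ m, pd m u y * gradient G u m y = s := by simp_rw [← hS, mul_comm]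
  have hB : ∀ a b, ∑ m, G y c m * ∑ n, christoffel G' m a n y * christoffel G' n b d y =
      ∑ n, L c a n * christoffel G n b d y + L c a b * pd d u y + L c a d * pd b u y
      - (∑ n, L c a n * gradient G u n y) * G y b d
      + G y c a * (N b d + 2 * pd b u y * pd d u y - s * G y b d)
      + pd a u y * (L c b d + G y c b * pd d u y + G y c d * pd b u y - pd c u y * G y b d)
      - pd c u y * (L a b d + G y a b * pd d u y + G y a d * pd b u y - pd a u y * G y b d) := by
    intro a b
    have e : ∑ m, G y c m * ∑ n, christoffel G' m a n y * christoffel G' n b d y =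
        ∑ n, (∑ m, G y c m * christoffel G' m a n y) * christoffel G' n b d y := by
      simp_rw [Finset.sum_mul, Finset.mul_sum]
      rw [Finset.sum_comm]
      simp_rw [mul_assoc]
    rw [e, h.sum_mul_christoffel hy]
    have e' : ∀ Z : Fin 4 → ℝ,
        ∑ n, (L c a n + G y c a * pd n u y + G y c n * pd a u y - pd c u y * G y a n) * Z n =
        ∑ n, L c a n * Z n + G y c a * ∑ n, pd n u y * Z n + pd a u y * ∑ n, G y c n * Z n
          - pd c u y * ∑ n, G y a n * Z n := fun Z => by
      simp only [Fin.sum_univ_four]; ring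
    simp_rw [hL', e', hN', hS', hL, h.lower_gradient hy]
    ring
  have hC := h.sum_metric_mul_pd_christoffel hy
  simp_rw [hg, add_mul, Finset.sum_add_distrib, hLU] at hC
  have hB0 : ∀ a b, ∑ m, G y c m * ∑ n, christoffel G m a n y * christoffel G n b d y =
      ∑ n, L c a n * christoffel G n b d y := by
    intro a b
    simp_rw [← hL, Finset.sum_mul, Finset.mul_sum]
    rw [Finset.sum_comm]
    simp_rw [mul_assoc]
  unfold riemann curvature schoutenChange
  simp_rw [h.eq y hy, mul_assoc, ← Finset.mul_sum, Finset.sum_sub_distrib, mul_add, mul_sub,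
    Finset.sum_add_distrib, Finset.sum_sub_distrib, hB, hC, hB0, hN, hS]
  rw [hs c a, hs c b, hs b a, hLs d b a, hLs c b a,
    pd_comm b a h.metric.isOpen h.smooth hy]
  ring

end IsConformalOn

/-! ### Conformal change of the Ricci, Schouten and Weyl tensors and of the Weyl divergence. -/

namespace IsConformalOn
variable {G G' : MetricField} {u : R4 → ℝ} {S : Set R4} {y : R4} (h : IsConformalOn G G' u S)
include h

theorem ricci_eq (hy : y ∈ S) (b d : Fin 4) :
    ricci G' b d y = ricci G b d y + 2 * schoutenChange G u b d y
      + G y b d * ∑ a, ∑ c, invMetric G y a c * schoutenChange G u a c y := by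
  have hE := Real.exp_ne_zero (2 * u y)
  rw [h.metric'.ricci_eq_sum_riemann hy, h.metric.ricci_eq_sum_riemann hy, add_assoc,
    ← h.metric.trace_kulkarniNomizu hy (fun a b => schoutenChange G u a b y)]
  simp_rw [← Finset.sum_add_distrib]
  refine Finset.sum_congr rfl fun a _ => Finset.sum_congr rfl fun c _ => ?_
  rw [h.invMetric_eq hy, h.riemann_eq hy]
  field_simp

theorem scalarCurv_eq (hy : y ∈ S) :
    scalarCurv G' y = (Real.exp (2 * u y))⁻¹ * (scalarCurv G y
      + 6 * ∑ a, ∑ c, invMetric G y a c * schoutenChange G u a c y) := by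
  obtain ⟨t, ht⟩ : ∃ t, ∑ a, ∑ c, invMetric G y a c * schoutenChange G u a c y = t := ⟨_, rfl⟩
  have e : scalarCurv G' y = (Real.exp (2 * u y))⁻¹ * (scalarCurv G y
      + 2 * (∑ a, ∑ c, invMetric G y a c * schoutenChange G u a c y)
      + (∑ a, ∑ c, invMetric G y a c * G y a c) * t) := by
    have hr := h.ricci_eq hy
    simp_rw [ht] at hr
    unfold scalarCurv
    simp_rw [hr, h.invMetric_eq hy, Finset.sum_mul, Finset.mul_sum,
      ← Finset.sum_add_distrib, Finset.mul_sum]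
    refine Finset.sum_congr rfl fun a _ => Finset.sum_congr rfl fun c _ => ?_
    ring
  rw [e, h.metric.trace_metric hy, ht]
  ring

theorem schouten_eq (hy : y ∈ S) (a b : Fin 4) :
    schouten G' a b y = schouten G a b y + schoutenChange G u a b y := by
  have hE := Real.exp_ne_zero (2 * u y)
  unfold schouten
  rw [h.ricci_eq hy, h.scalarCurv_eq hy, h.eq y hy]
  field_simp
  ring

/-- The Kulkarni–Nomizu correction of the Riemann tensor is built from precisely the change of the
Schouten tensor, so it drops out. -/
theorem weyl_eq (hy : y ∈ S) (a b c d : Fin 4) :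
    weyl G' a b c d y = Real.exp (2 * u y) * weyl G a b c d y := by
  unfold weyl
  simp_rw [h.riemann_eq hy, h.schouten_eq hy, h.eq y hy]
  ring

/-- Here and in the next three lemmas a gradient contracted with any slot is moved to the last slot,
so that only one kind of contraction survives in `nablaWeyl_eq`. -/
theorem sum_gradient_mul_weyl_fst (hy : y ∈ S) (b c d : Fin 4) :
    ∑ m, weyl G m b c d y * gradient G u m y = - ∑ m, gradient G u m y * weyl G c d b m y := by
  rw [← Finset.sum_neg_distrib]
  refine Finset.sum_congr rfl fun m _ => ?_
  rw [h.metric.weyl_pair_symm hy, h.metric.weyl_antisymm_right hy]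
  ring

theorem sum_gradient_mul_weyl_snd (hy : y ∈ S) (a c d : Fin 4) :
    ∑ m, weyl G a m c d y * gradient G u m y = ∑ m, gradient G u m y * weyl G c d a m y := by
  refine Finset.sum_congr rfl fun m _ => ?_
  rw [h.metric.weyl_pair_symm hy]
  ring

theorem sum_gradient_mul_weyl_trd (hy : y ∈ S) (a b d : Fin 4) :
    ∑ m, weyl G a b m d y * gradient G u m y = - ∑ m, gradient G u m y * weyl G a b d m y := by
  rw [← Finset.sum_neg_distrib]
  refine Finset.sum_congr rfl fun m _ => ?_
  rw [h.metric.weyl_antisymm_right hy]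
  ring

omit h in
theorem sum_gradient_mul_weyl_fth (a b c : Fin 4) :
    ∑ m, weyl G a b c m y * gradient G u m y = ∑ m, gradient G u m y * weyl G a b c m y := by
  simp_rw [mul_comm]

/-- The coefficient `-2` of `∂_f u C_{abcd}` is `2 - 4`: the derivative of the factor `exp (2 u)`
gives `2`, and each of the four Christoffel corrections gives `-1`. -/
theorem nablaWeyl_eq (hy : y ∈ S) (f a b c d : Fin 4) :
    nablaWeyl G' f a b c d y = Real.exp (2 * u y) * (nablaWeyl G f a b c d y
      - 2 * pd f u y * weyl G a b c d y
      - pd a u y * weyl G f b c d y - pd b u y * weyl G a f c d y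
      - pd c u y * weyl G a b f d y - pd d u y * weyl G a b c f y
      - G y f a * (∑ m, gradient G u m y * weyl G c d b m y)
      + G y f b * (∑ m, gradient G u m y * weyl G c d a m y)
      - G y f c * (∑ m, gradient G u m y * weyl G a b d m y)
      + G y f d * (∑ m, gradient G u m y * weyl G a b c m y)) := by
  have h1 := h.differentiableAt_potential hy
  have h2 := (h.metric.smooth_weyl a b c d).differentiableAt_of_isOpen h.metric.isOpen hy
  have e : nablaWeyl G' f a b c d y = pd f (weyl G' a b c d) y
    - Real.exp (2 * u y) * (∑ m, weyl G m b c d y * christoffel G' m f a y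
      + ∑ m, weyl G a m c d y * christoffel G' m f b y
      + ∑ m, weyl G a b m d y * christoffel G' m f c y
      + ∑ m, weyl G a b c m y * christoffel G' m f d y) := by
    unfold nablaWeyl
    simp_rw [h.weyl_eq hy, ← Finset.sum_add_distrib, Finset.mul_sum]
    congr 1
    refine Finset.sum_congr rfl fun m _ => ?_
    ring
  rw [e, pd_congr_on f h.metric.isOpen hy fun z hz => h.weyl_eq hz a b c d,
    pd_mul f (by fun_prop) h2, pd_exp_two_mul f h1,
    h.sum_mul_christoffel hy, h.sum_mul_christoffel hy, h.sum_mul_christoffel hy,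
    h.sum_mul_christoffel hy, h.sum_gradient_mul_weyl_fst hy, h.sum_gradient_mul_weyl_snd hy,
    h.sum_gradient_mul_weyl_trd hy, sum_gradient_mul_weyl_fth]
  unfold nablaWeyl
  simp_rw [Finset.sum_add_distrib, mul_comm (weyl _ _ _ _ _ _) (christoffel _ _ _ _ _)]
  ring

/-- The traces of `C` vanish. The direct multiples of `∇^m u C_{bcdm}` have coefficients `-2 - 1 - 1
+ 4 = 0`, where `4` is the trace of the metric; the two remaining terms, with permuted indices,
contribute `1` by the cyclic identity. -/
theorem divWeyl_eq (hy : y ∈ S) (b c d : Fin 4) :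
    divWeyl G' b c d y = divWeyl G b c d y + ∑ m, gradient G u m y * weyl G b c d m y := by
  have hE := Real.exp_ne_zero (2 * u y)
  obtain ⟨W, hW⟩ : ∃ W : Fin 4 → Fin 4 → Fin 4 → ℝ,
      ∀ b c d, ∑ m, gradient G u m y * weyl G b c d m y = W b c d := ⟨_, fun _ _ _ => rfl⟩
  have e : divWeyl G' b c d y = divWeyl G b c d y
      - 2 * (∑ e, ∑ f, invMetric G y e f * (pd f u y * weyl G b c d e y))
      - pd b u y * (∑ e, ∑ f, invMetric G y e f * weyl G f c d e y)
      - pd c u y * (∑ e, ∑ f, invMetric G y e f * weyl G b f d e y)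
      - pd d u y * (∑ e, ∑ f, invMetric G y e f * weyl G b c f e y)
      - (∑ e, ∑ f, invMetric G y e f * (pd e u y * weyl G b c d f y))
      - (∑ e, ∑ f, invMetric G y e f * (G y f b * W d e c))
      + (∑ e, ∑ f, invMetric G y e f * (G y f c * W d e b))
      - (∑ e, ∑ f, invMetric G y e f * (G y f d * W b c e))
      + (∑ e, ∑ f, invMetric G y e f * G y f e) * W b c d := by
    unfold divWeyl
    simp_rw [h.invMetric_eq hy, h.nablaWeyl_eq hy, hW, Finset.sum_mul, Finset.mul_sum,
      ← Finset.sum_sub_distrib, ← Finset.sum_add_distrib, ← Finset.sum_sub_distrib,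
      ← Finset.sum_add_distrib]
    refine Finset.sum_congr rfl fun e _ => Finset.sum_congr rfl fun f _ => ?_
    field_simp
  have t1 : ∀ b c d, ∑ e, ∑ f, invMetric G y e f * (pd f u y * weyl G b c d e y) = W b c d := by
    intro b c d
    simp_rw [← hW, gradient, Finset.sum_mul]
    refine Finset.sum_congr rfl fun e _ => Finset.sum_congr rfl fun f _ => ?_
    ring
  have t2 : ∑ e, ∑ f, invMetric G y e f * weyl G f c d e y = 0 := by
    rw [Finset.sum_comm, ← neg_eq_zero, ← h.metric.weyl_trace hy c d]
    simp_rw [← Finset.sum_neg_distrib]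
    refine Finset.sum_congr rfl fun e _ => Finset.sum_congr rfl fun f _ => ?_
    rw [h.metric.weyl_antisymm_right hy, h.metric.inv_symm hy]
    ring
  have t3 : ∑ e, ∑ f, invMetric G y e f * weyl G b f d e y = 0 := by
    rw [Finset.sum_comm, ← h.metric.weyl_trace hy b d]
    refine Finset.sum_congr rfl fun e _ => Finset.sum_congr rfl fun f _ => ?_
    rw [h.metric.weyl_antisymm_right hy, IsMetricOn.weyl_antisymm_left, h.metric.inv_symm hy]
    ring
  have t4 : ∑ e, ∑ f, invMetric G y e f * weyl G b c f e y = 0 := by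
    have : ∑ e, ∑ f, invMetric G y e f * weyl G b c f e y =
        - ∑ e, ∑ f, invMetric G y e f * weyl G b c f e y := by
      conv_lhs => rw [Finset.sum_comm]
      simp_rw [← Finset.sum_neg_distrib]
      refine Finset.sum_congr rfl fun e _ => Finset.sum_congr rfl fun f _ => ?_
      rw [h.metric.weyl_antisymm_right hy, h.metric.inv_symm hy]
      ring
    linarith
  have t5 : ∑ e, ∑ f, invMetric G y e f * (pd e u y * weyl G b c d f y) = W b c d := by
    rw [← t1, Finset.sum_comm]
    refine Finset.sum_congr rfl fun e _ => Finset.sum_congr rfl fun f _ => ?_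
    rw [h.metric.inv_symm hy]
  have t6 : ∀ (X : Fin 4 → ℝ) b, ∑ e, ∑ f, invMetric G y e f * (G y f b * X e) = X b := by
    intro X b
    rw [← h.metric.trace_metric_right hy X b]
    refine Finset.sum_congr rfl fun e _ => Finset.sum_congr rfl fun f _ => ?_
    rw [h.metric.symm y hy b]
  have t7 : ∑ e, ∑ f, invMetric G y e f * G y f e = 4 := by
    simp_rw [h.metric.sum_inv_metric hy]
    simp
  have c1 : W b c d + W c d b + W d b c = 0 := by
    simp_rw [← hW, ← Finset.sum_add_distrib]
    refine Finset.sum_eq_zero fun m _ => ?_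
    rw [h.metric.weyl_antisymm_right hy b, h.metric.weyl_antisymm_right hy c,
      h.metric.weyl_antisymm_right hy d]
    linear_combination (-gradient G u m y) * h.metric.weyl_cyclic hy b c m d
  have c2 : W d c b = - W c d b := by
    simp_rw [← hW, ← Finset.sum_neg_distrib]
    refine Finset.sum_congr rfl fun m _ => ?_
    rw [IsMetricOn.weyl_antisymm_left]
    ring
  rw [e, t1, t2, t3, t4, t5, t6 (fun e => W d e c), t6 (fun e => W d e b),
    t6 (fun e => W b c e), t7, hW]
  linear_combination (-1 : ℝ) * c1 + c2

end IsConformalOn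

/-! ### The quadratic identity for Weyl tensors in dimension four. -/

/-- In dimension four, `C_{ijkl} C_{ijkm}` is a multiple of the identity for every tensor with the
algebraic symmetries of the Weyl tensor. -/
theorem exists_weyl_square_eq_of_orthonormal {C : Fin 4 → Fin 4 → Fin 4 → Fin 4 → ℝ}
    (hl : ∀ a b c d, C a b c d = - C b a c d) (hr : ∀ a b c d, C a b c d = - C a b d c)
    (hp : ∀ a b c d, C a b c d = C c d a b)
    (hc : ∀ a b c d, C a b c d + C b d c a + C d a c b = 0)
    (ht : ∀ b d, ∑ a, C a b a d = 0) :
    ∃ r : ℝ, ∀ l m, ∑ i, ∑ j, ∑ k, C i j k l * C i j k m = if l = m then r else 0 := by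
  have z1 : ∀ i k l, C i i k l = 0 := fun i k l => by linarith [hl i i k l]
  have z2 : ∀ i j k, C i j k k = 0 := fun i j k => by linarith [hr i j k k]
  have l10 := hl 1 0
  have l20 := hl 2 0
  have l30 := hl 3 0
  have l21 := hl 2 1
  have l31 := hl 3 1
  have l32 := hl 3 2
  have r10 := fun a b => hr a b 1 0
  have r20 := fun a b => hr a b 2 0
  have r30 := fun a b => hr a b 3 0
  have r21 := fun a b => hr a b 2 1
  have r31 := fun a b => hr a b 3 1
  have r32 := fun a b => hr a b 3 2
  have p1 := hp 0 2 0 1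
  have p2 := hp 0 3 0 1
  have p3 := hp 1 2 0 1
  have p4 := hp 1 3 0 1
  have p5 := hp 2 3 0 1
  have p6 := hp 0 3 0 2
  have p7 := hp 1 2 0 2
  have p8 := hp 1 3 0 2
  have p9 := hp 2 3 0 2
  have p10 := hp 1 2 0 3
  have p11 := hp 1 3 0 3
  have p12 := hp 2 3 0 3
  have p13 := hp 1 3 1 2
  have p14 := hp 2 3 1 2
  have p15 := hp 2 3 1 3
  have cy := hc 0 1 2 3
  have t00 := ht 0 0
  have t11 := ht 1 1
  have t22 := ht 2 2
  have t33 := ht 3 3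
  have t01 := ht 0 1
  have t02 := ht 0 2
  have t03 := ht 0 3
  have t12 := ht 1 2
  have t13 := ht 1 3
  have t23 := ht 2 3
  simp only [Fin.sum_univ_four, z1, z2, l10, l20, l30, l21, l31, l32, r10, r20, r30, r21, r31, r32,
    p8] at cy t00 t11 t22 t33 t01 t02 t03 t12 t13 t23
  -- The pair symmetries leave 21 components; the cyclic and trace conditions eliminate eleven of
  -- them, leaving the ten independent components of a four-dimensional Weyl tensor.
  have e1 : C 2 3 2 3 = C 0 1 0 1 := by linarith
  have e2 : C 1 3 1 3 = C 0 2 0 2 := by linarith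
  have e3 : C 1 2 1 2 = C 0 3 0 3 := by linarith
  have e4 : C 0 3 0 3 = - C 0 1 0 1 - C 0 2 0 2 := by linarith
  have e5 : C 0 3 1 3 = - C 0 2 1 2 := by linarith
  have e6 : C 0 3 2 3 = C 0 1 1 2 := by linarith
  have e7 : C 0 2 2 3 = - C 0 1 1 3 := by linarith
  have e8 : C 1 3 2 3 = - C 0 1 0 2 := by linarith
  have e9 : C 1 2 2 3 = C 0 1 0 3 := by linarith
  have e10 : C 1 2 1 3 = - C 0 2 0 3 := by linarith
  have e11 : C 0 3 1 2 = C 0 2 1 3 - C 0 1 2 3 := by linarith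
  -- The factor is read off from the entry `l = m = 0`; in the ten remaining components every other
  -- entry becomes a polynomial identity.
  refine ⟨∑ i, ∑ j, ∑ k, C i j k 0 * C i j k 0, fun l m => ?_⟩
  fin_cases l <;> fin_cases m <;>
  · simp only [Fin.zero_eta, Fin.mk_one, Fin.reduceFinMk, Fin.isValue, Fin.reduceEq, if_true,
      if_false, Fin.sum_univ_four, z1, z2, l10, l20, l30, l21, l31, l32, r10, r20, r30, r21, r31,
      r32, p1, p2, p3, p4, p5, p6, p7, p8, p9, p10, p11, p12, p13, p14, p15, e1, e2, e3, e4, e5, e6,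
      e7, e8, e9, e10, e11]
    try ring


theorem sum_comm_triple (F : Fin 4 → Fin 4 → Fin 4 → Fin 4 → Fin 4 → Fin 4 → ℝ) :
    ∑ a, ∑ b, ∑ c, ∑ i, ∑ j, ∑ k, F a b c i j k = ∑ i, ∑ j, ∑ k, ∑ a, ∑ b, ∑ c, F a b c i j k := by
  have := Finset.sum_comm (s := Finset.univ) (t := Finset.univ)
    (f := fun p q : Fin 4 × Fin 4 × Fin 4 => F p.1 p.2.1 p.2.2 q.1 q.2.1 q.2.2)
  simpa [Fintype.sum_prod_type] using this

theorem sum_comm_pair (F : Fin 4 → Fin 4 → Fin 4 → Fin 4 → ℝ) :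
    ∑ a, ∑ b, ∑ i, ∑ j, F a b i j = ∑ i, ∑ j, ∑ a, ∑ b, F a b i j := by
  have := Finset.sum_comm (s := Finset.univ) (t := Finset.univ)
    (f := fun p q : Fin 4 × Fin 4 => F p.1 p.2 q.1 q.2)
  simpa [Fintype.sum_prod_type] using this

theorem sum_comm_triple_single (F : Fin 4 → Fin 4 → Fin 4 → Fin 4 → ℝ) :
    ∑ a, ∑ b, ∑ c, ∑ i, F a b c i = ∑ i, ∑ a, ∑ b, ∑ c, F a b c i := by
  have := Finset.sum_comm (s := Finset.univ) (t := Finset.univ)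
    (f := fun (p : Fin 4 × Fin 4 × Fin 4) (q : Fin 4) => F p.1 p.2.1 p.2.2 q)
  simpa [Fintype.sum_prod_type] using this

theorem sum_comm_single_quad (F : Fin 4 → Fin 4 → Fin 4 → Fin 4 → Fin 4 → ℝ) :
    ∑ i, ∑ a, ∑ b, ∑ c, ∑ d, F i a b c d = ∑ a, ∑ b, ∑ c, ∑ d, ∑ i, F i a b c d := by
  have := Finset.sum_comm (s := Finset.univ) (t := Finset.univ)
    (f := fun (q : Fin 4) (p : Fin 4 × Fin 4 × Fin 4 × Fin 4) => F q p.1 p.2.1 p.2.2.1 p.2.2.2)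
  simpa [Fintype.sum_prod_type] using this

theorem sum_rev_triple (F : Fin 4 → Fin 4 → Fin 4 → ℝ) :
    ∑ a, ∑ b, ∑ c, F a b c = ∑ c, ∑ b, ∑ a, F a b c := by
  simp_rw [Finset.sum_comm (f := fun b c => F _ b c)]
  rw [Finset.sum_comm]
  simp_rw [Finset.sum_comm (f := fun a b => F a b _)]

theorem sum_cycle (F : Fin 4 → Fin 4 → Fin 4 → Fin 4 → ℝ) :
    ∑ a, ∑ b, ∑ c, ∑ d, F a b c d = ∑ a, ∑ b, ∑ c, ∑ d, F b d c a := by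
  conv_rhs => rw [Finset.sum_comm]
  refine Finset.sum_congr rfl fun x _ => ?_
  rw [sum_rev_triple]

/-- The columns of `E` form an orthonormal frame for `A`, and the rows of `B` are the dual coframe.
-/
theorem exists_frame_of_posDef {A : Matrix (Fin 4) (Fin 4) ℝ} (hA : A.PosDef) :
    ∃ B E : Matrix (Fin 4) (Fin 4) ℝ, E * B = 1 ∧ A = B.transpose * B ∧
      A⁻¹ = E * E.transpose := by
  open scoped MatrixOrder in
  obtain ⟨B, hB, rfl⟩ := CStarAlgebra.isStrictlyPositive_iff_eq_star_mul_self.1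
    (Matrix.isStrictlyPositive_iff_posDef.2 hA)
  have hd := (Matrix.isUnit_iff_isUnit_det B).1 hB
  refine ⟨B, B⁻¹, Matrix.nonsing_inv_mul B hd, ?_, ?_⟩
  · rw [Matrix.star_eq_conjTranspose, Matrix.conjTranspose_eq_transpose_of_trivial]
  · rw [Matrix.star_eq_conjTranspose, Matrix.conjTranspose_eq_transpose_of_trivial,
      Matrix.mul_inv_rev, Matrix.transpose_nonsing_inv]

/-- The components of a covariant 4-tensor in the frame `E`. -/
def frameTensor (E : Matrix (Fin 4) (Fin 4) ℝ) (C : Fin 4 → Fin 4 → Fin 4 → Fin 4 → ℝ)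
    (i j k l : Fin 4) : ℝ :=
  ∑ a, ∑ b, ∑ c, ∑ d, E a i * E b j * E c k * E d l * C a b c d

/-- In dimension four, `C^{bcd}{}_a C_{bcde}` is a multiple of the metric. -/
theorem exists_weyl_square_eq {A : Matrix (Fin 4) (Fin 4) ℝ} (hA : A.PosDef)
    {C : Fin 4 → Fin 4 → Fin 4 → Fin 4 → ℝ}
    (hl : ∀ a b c d, C a b c d = - C b a c d) (hr : ∀ a b c d, C a b c d = - C a b d c)
    (hp : ∀ a b c d, C a b c d = C c d a b)
    (hc : ∀ a b c d, C a b c d + C b d c a + C d a c b = 0)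
    (ht : ∀ b d, ∑ a, ∑ c, A⁻¹ a c * C a b c d = 0) :
    ∃ (r : ℝ) (E : Matrix (Fin 4) (Fin 4) ℝ) (T : Fin 4 → Fin 4 → Fin 4 → Fin 4 → ℝ),
      (∀ a e, ∑ i, ∑ j, ∑ k, T i j k a * T i j k e = r * A a e) ∧
      (∀ b c d a, ∑ b', ∑ c', ∑ d', A⁻¹ b b' * A⁻¹ c c' * A⁻¹ d d' * C b' c' d' a =
        ∑ i, ∑ j, ∑ k, E b i * E c j * E d k * T i j k a) ∧
      (∀ i j k a, T i j k a = ∑ b, ∑ c, ∑ d, E b i * E c j * E d k * C b c d a) := by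
  obtain ⟨B, E, hEB, hAB, hAE⟩ := exists_frame_of_posDef hA
  have hA' : ∀ a b, A a b = ∑ k, B k a * B k b := fun a b => by
    rw [hAB]; simp [Matrix.mul_apply]
  have hH : ∀ a b, A⁻¹ a b = ∑ k, E a k * E b k := fun a b => by
    rw [hAE]; simp [Matrix.mul_apply]
  have hEB' : ∀ a b, ∑ k, E a k * B k b = if a = b then 1 else 0 := fun a b => by
    have := congrFun (congrFun hEB a) b
    simpa [Matrix.mul_apply, Matrix.one_apply] using this
  -- The symmetries pass to the frame components by relabelling sums; the trace with `A⁻¹ = E Eᵀ`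
  -- becomes the plain trace over repeated frame indices.
  obtain ⟨r, hr'⟩ := exists_weyl_square_eq_of_orthonormal (C := frameTensor E C)
    (fun i j k l => by
      unfold frameTensor
      rw [Finset.sum_comm]
      simp_rw [← Finset.sum_neg_distrib]
      refine Finset.sum_congr rfl fun a _ => Finset.sum_congr rfl fun b _ =>
        Finset.sum_congr rfl fun c _ => Finset.sum_congr rfl fun d _ => ?_
      rw [hl]; ring)
    (fun i j k l => by
      unfold frameTensor
      simp_rw [← Finset.sum_neg_distrib]
      refine Finset.sum_congr rfl fun a _ => Finset.sum_congr rfl fun b _ => ?_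
      rw [Finset.sum_comm]
      refine Finset.sum_congr rfl fun c _ => Finset.sum_congr rfl fun d _ => ?_
      rw [hr]; ring)
    (fun i j k l => by
      unfold frameTensor
      rw [sum_comm_pair]
      refine Finset.sum_congr rfl fun a _ => Finset.sum_congr rfl fun b _ =>
        Finset.sum_congr rfl fun c _ => Finset.sum_congr rfl fun d _ => ?_
      rw [hp]; ring)
    (fun i j k l => by
      unfold frameTensor
      rw [sum_cycle fun a b c d => E a j * E b l * E c k * E d i * C a b c d,
        sum_cycle fun a b c d => E a l * E b i * E c k * E d j * C a b c d,
        sum_cycle fun a b c d => E b l * E d i * E c k * E a j * C b d c a]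
      simp_rw [← Finset.sum_add_distrib]
      refine Finset.sum_eq_zero fun a _ => Finset.sum_eq_zero fun b _ =>
        Finset.sum_eq_zero fun c _ => Finset.sum_eq_zero fun d _ => ?_
      linear_combination (E a i * E b j * E c k * E d l) * hc a b c d)
    (fun j l => by
      have e : ∑ i, frameTensor E C i j i l =
          ∑ b, ∑ d, E b j * E d l * ∑ a, ∑ c, A⁻¹ a c * C a b c d := by
        unfold frameTensor
        rw [sum_comm_single_quad, Finset.sum_comm]
        refine Finset.sum_congr rfl fun b _ => ?_
        simp_rw [Finset.sum_comm (f := fun c d => ∑ i, E _ i * E b j * E c i * E d l * C _ b c d)]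
        rw [Finset.sum_comm]
        refine Finset.sum_congr rfl fun d _ => ?_
        simp_rw [hH, Finset.sum_mul, Finset.mul_sum]
        refine Finset.sum_congr rfl fun a _ => Finset.sum_congr rfl fun c _ =>
          Finset.sum_congr rfl fun i _ => ?_
        ring
      rw [e]
      simp [ht])
  have hC' : ∀ i j k l, frameTensor E C i j k l =
      ∑ d, E d l * ∑ a, ∑ b, ∑ c, E a i * E b j * E c k * C a b c d := fun i j k l => by
    unfold frameTensor
    rw [sum_comm_triple_single]
    simp_rw [Finset.mul_sum]
    refine Finset.sum_congr rfl fun d _ => Finset.sum_congr rfl fun a _ =>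
      Finset.sum_congr rfl fun b _ => Finset.sum_congr rfl fun c _ => ?_
    ring
  -- `T` has its first three indices in the frame and the last in coordinates. The contraction over
  -- the three frame indices is then a sum of products without metric factors, and a sum of squares
  -- on the diagonal.
  refine ⟨r, E, fun i j k a => ∑ b, ∑ c, ∑ d, E b i * E c j * E d k * C b c d a,
    fun a e => ?_, fun b c d a => ?_, fun _ _ _ _ => rfl⟩
  -- The last index is expanded in the coframe, which reduces the contraction to the orthonormal
  -- case.
  · have hT : ∀ i j k a, ∑ b, ∑ c, ∑ d, E b i * E c j * E d k * C b c d a =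
        ∑ l, frameTensor E C i j k l * B l a := fun i j k a => by
      symm
      simp_rw [hC', Finset.sum_mul]
      rw [Finset.sum_comm]
      have : ∀ (X : ℝ) d, ∑ l, E d l * X * B l a = X * if d = a then 1 else 0 := fun X d => by
        rw [← hEB', Finset.mul_sum]
        exact Finset.sum_congr rfl fun l _ => by ring
      simp_rw [this]
      simp
    simp_rw [hT, Finset.sum_mul_sum]
    have e1 : ∑ i, ∑ j, ∑ k, ∑ l, ∑ m,
        frameTensor E C i j k l * B l a * (frameTensor E C i j k m * B m e) =
        ∑ l, ∑ m, (∑ i, ∑ j, ∑ k, frameTensor E C i j k l * frameTensor E C i j k m)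
          * (B l a * B m e) := by
      rw [sum_comm_triple_single]
      refine Finset.sum_congr rfl fun l _ => ?_
      rw [sum_comm_triple_single]
      simp_rw [Finset.sum_mul]
      refine Finset.sum_congr rfl fun m _ => Finset.sum_congr rfl fun i _ =>
        Finset.sum_congr rfl fun j _ => Finset.sum_congr rfl fun k _ => ?_
      ring
    rw [e1]
    simp_rw [hr', hA', Finset.mul_sum]
    simp
  · have tri : ∀ (f g h : Fin 4 → ℝ) (X : ℝ), (∑ i, f i) * (∑ j, g j) * (∑ k, h k) * X =
        ∑ i, ∑ j, ∑ k, f i * g j * h k * X := fun f g h X => by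
      simp only [Fin.sum_univ_four]; ring
    simp_rw [hH, tri, Finset.mul_sum]
    rw [sum_comm_triple]
    refine Finset.sum_congr rfl fun i _ => Finset.sum_congr rfl fun j _ =>
      Finset.sum_congr rfl fun k _ => Finset.sum_congr rfl fun b' _ =>
      Finset.sum_congr rfl fun c' _ => Finset.sum_congr rfl fun d' _ => ?_
    ring


/-! ### Contraction of the Weyl tensor of a metric with itself. -/

namespace IsMetricOn
variable {G : MetricField} {S : Set R4} {y : R4} (hG : IsMetricOn G S)
include hG

/-- The trace of the quadratic identity gives `|C|² = 4 r`. Positive definiteness enters in the last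
clause: it makes `r` vanish only with the Weyl tensor, so that the division by `|C|²` in `V` is
legitimate. -/
theorem exists_weylUp_contract (hy : y ∈ S) :
    ∃ r : ℝ, (∀ a e, ∑ b, ∑ c, ∑ d, weylUp G b c d a y * weyl G b c d e y = r * G y a e) ∧
      weylNormSq G y = 4 * r ∧ ((∃ a b c d, weyl G a b c d y ≠ 0) → r ≠ 0) := by
  obtain ⟨r, E, T, h1, h2, h3⟩ := exists_weyl_square_eq (hG.posDef y hy)
    (C := fun a b c d => weyl G a b c d y) (fun a b c d => weyl_antisymm_left a b c d)
    (hG.weyl_antisymm_right hy) (hG.weyl_pair_symm hy) (hG.weyl_cyclic hy) (hG.weyl_trace hy)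
  have h2' : ∀ b c d a, weylUp G b c d a y = ∑ i, ∑ j, ∑ k, E b i * E c j * E d k * T i j k a := h2
  have hK : ∀ a e, ∑ b, ∑ c, ∑ d, weylUp G b c d a y * weyl G b c d e y = r * G y a e := by
    intro a e
    rw [← h1]
    simp_rw [h2', Finset.sum_mul]
    rw [sum_comm_triple]
    refine Finset.sum_congr rfl fun i _ => Finset.sum_congr rfl fun j _ =>
      Finset.sum_congr rfl fun k _ => ?_
    rw [h3 i j k e]
    simp_rw [Finset.mul_sum]
    refine Finset.sum_congr rfl fun b _ => Finset.sum_congr rfl fun c _ =>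
      Finset.sum_congr rfl fun d _ => ?_
    ring
  refine ⟨r, hK, ?_, ?_⟩
  · have e : weylNormSq G y = ∑ d, ∑ d', invMetric G y d d' *
        ∑ a, ∑ b, ∑ c, weylUp G a b c d' y * weyl G a b c d y := by
      unfold weylNormSq
      rw [sum_comm_triple_single]
      refine Finset.sum_congr rfl fun d _ => ?_
      rw [sum_comm_triple_single]
      simp_rw [Finset.mul_sum]
      refine Finset.sum_congr rfl fun d' _ => Finset.sum_congr rfl fun a _ =>
        Finset.sum_congr rfl fun b _ => Finset.sum_congr rfl fun c _ => ?_
      ring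
    rw [e]
    have e' : ∀ d, ∑ d', invMetric G y d d' * (r * G y d' d) = r := fun d => by
      have : ∑ d', invMetric G y d d' * (r * G y d' d) =
          r * ∑ d', invMetric G y d d' * G y d' d := by
        rw [Finset.mul_sum]; exact Finset.sum_congr rfl fun _ _ => by ring
      rw [this, hG.sum_inv_metric hy]; simp
    simp_rw [hK, e']
    simp
  · rintro ⟨a, b, c, d, hne⟩ rfl
    refine hne ?_
    -- With `r = 0` the diagonal entries are vanishing sums of squares.
    have hT : ∀ i j k a, T i j k a = 0 := by
      intro i j k a
      have h0 := h1 a a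
      rw [zero_mul, Finset.sum_eq_zero_iff_of_nonneg
        fun i _ => Finset.sum_nonneg fun j _ => Finset.sum_nonneg fun k _ => mul_self_nonneg _] at h0
      have h0 := h0 i (Finset.mem_univ _)
      rw [Finset.sum_eq_zero_iff_of_nonneg
        fun j _ => Finset.sum_nonneg fun k _ => mul_self_nonneg _] at h0
      have h0 := h0 j (Finset.mem_univ _)
      rw [Finset.sum_eq_zero_iff_of_nonneg fun k _ => mul_self_nonneg _] at h0
      exact mul_self_eq_zero.1 (h0 k (Finset.mem_univ _))
    have hup : ∀ b c d a, weylUp G b c d a y = 0 := fun b c d a => by simp [h2', hT]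
    -- Raising an index is injective; it is undone for the three raised indices one at a time.
    have inj : ∀ X : Fin 4 → ℝ, (∀ b, ∑ m, invMetric G y b m * X m = 0) → ∀ m, X m = 0 := by
      intro X hX m
      rw [← hG.lower_raise hy X m]
      simp [hX]
    have f1 : ∀ b c a m, ∑ c', ∑ d', invMetric G y b c' * invMetric G y c d' * weyl G m c' d' a y
        = 0 := fun b c a m => by
      refine inj (fun m => ∑ c', ∑ d', invMetric G y b c' * invMetric G y c d' *
        weyl G m c' d' a y) (fun i => ?_) m
      rw [← hup i b c a]
      unfold weylUp
      simp_rw [Finset.mul_sum, mul_assoc]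
    have f2 : ∀ c a m n, ∑ d', invMetric G y c d' * weyl G m n d' a y = 0 := fun c a m n => by
      refine inj (fun n => ∑ d', invMetric G y c d' * weyl G m n d' a y) (fun i => ?_) n
      rw [← f1 i c a m]
      simp_rw [Finset.mul_sum, mul_assoc]
    exact inj (fun c => weyl G a b c d y) (fun i => f2 i d a b) c

theorem weylUp_contract (hy : y ∈ S) (a e : Fin 4) :
    ∑ b, ∑ c, ∑ d, weylUp G b c d a y * weyl G b c d e y = 1 / 4 * weylNormSq G y * G y a e := by
  obtain ⟨r, h1, h2, -⟩ := hG.exists_weylUp_contract hy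
  rw [h1, h2]
  ring

theorem weylNormSq_ne_zero (hy : y ∈ S) (h : ∃ a b c d, weyl G a b c d y ≠ 0) :
    weylNormSq G y ≠ 0 := by
  obtain ⟨r, -, h2, h3⟩ := hG.exists_weylUp_contract hy
  rw [h2]
  exact mul_ne_zero four_ne_zero (h3 h)

theorem weylUp_contract_sum (hy : y ∈ S) (U : Fin 4 → ℝ) (a : Fin 4) :
    ∑ b, ∑ c, ∑ d, weylUp G b c d a y * ∑ m, U m * weyl G b c d m y =
      1 / 4 * weylNormSq G y * ∑ m, G y a m * U m := by
  have e : ∑ b, ∑ c, ∑ d, weylUp G b c d a y * ∑ m, U m * weyl G b c d m y =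
      ∑ m, U m * ∑ b, ∑ c, ∑ d, weylUp G b c d a y * weyl G b c d m y := by
    simp_rw [Finset.mul_sum]
    rw [sum_comm_triple_single]
    refine Finset.sum_congr rfl fun m _ => Finset.sum_congr rfl fun b _ =>
      Finset.sum_congr rfl fun c _ => Finset.sum_congr rfl fun d _ => ?_
    ring
  rw [e]
  simp_rw [hG.weylUp_contract hy, Finset.mul_sum]
  refine Finset.sum_congr rfl fun m _ => ?_
  ring

theorem ricci_eq_zero_of_schouten_eq_zero (hy : y ∈ S) (h : ∀ a b, schouten G a b y = 0)
    (a b : Fin 4) : ricci G a b y = 0 := by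
  have h1 := hG.trace_schouten hy
  simp only [h, mul_zero, Finset.sum_const_zero] at h1
  have h2 : scalarCurv G y = 0 := by linarith
  have h3 := h a b
  unfold schouten at h3
  rw [h2] at h3
  linarith

end IsMetricOn

/-! ### Conformal change of `V`, invariance of `T`, and Ricci-flat rescalings. -/

namespace IsConformalOn
variable {G G' : MetricField} {u : R4 → ℝ} {S : Set R4} {y : R4} (h : IsConformalOn G G' u S)
include h

theorem weylUp_eq (hy : y ∈ S) (b c d a : Fin 4) :
    weylUp G' b c d a y = (Real.exp (2 * u y))⁻¹ ^ 2 * weylUp G b c d a y := by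
  have hE := Real.exp_ne_zero (2 * u y)
  unfold weylUp
  simp_rw [h.invMetric_eq hy, h.weyl_eq hy, Finset.mul_sum]
  refine Finset.sum_congr rfl fun b _ => Finset.sum_congr rfl fun c _ =>
    Finset.sum_congr rfl fun d _ => ?_
  field_simp

theorem weylNormSq_eq (hy : y ∈ S) :
    weylNormSq G' y = (Real.exp (2 * u y))⁻¹ ^ 2 * weylNormSq G y := by
  have hE := Real.exp_ne_zero (2 * u y)
  unfold weylNormSq
  simp_rw [h.invMetric_eq hy, h.weyl_eq hy, h.weylUp_eq hy, Finset.mul_sum]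
  refine Finset.sum_congr rfl fun b _ => Finset.sum_congr rfl fun c _ =>
    Finset.sum_congr rfl fun d _ => Finset.sum_congr rfl fun d _ => Finset.sum_congr rfl fun d _ => ?_
  field_simp

/-- By the quadratic identity the extra term of the divergence contributes `¼ |C|² ∂_a u` to the
contraction, and the prefactor `4 / |C|²` turns it into `∂_a u`. The powers of `exp (2 u)` in the
contraction and in `|C|²` agree and cancel. -/
theorem oneFormV_eq (hy : y ∈ S) (hN : weylNormSq G y ≠ 0) (a : Fin 4) :
    oneFormV G' a y = oneFormV G a y + pd a u y := by
  have hE := Real.exp_ne_zero (2 * u y)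
  have e : ∑ b, ∑ c, ∑ d, weylUp G' b c d a y * divWeyl G' b c d y =
      (Real.exp (2 * u y))⁻¹ ^ 2 * (∑ b, ∑ c, ∑ d, weylUp G b c d a y * divWeyl G b c d y
        + 1 / 4 * weylNormSq G y * pd a u y) := by
    rw [← h.lower_gradient hy, ← h.metric.weylUp_contract_sum hy (fun m => gradient G u m y)]
    simp_rw [h.weylUp_eq hy, h.divWeyl_eq hy, ← Finset.sum_add_distrib, Finset.mul_sum]
    refine Finset.sum_congr rfl fun b _ => Finset.sum_congr rfl fun c _ =>
      Finset.sum_congr rfl fun d _ => ?_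
    rw [← Finset.mul_sum]
    ring
  unfold oneFormV
  rw [e, h.weylNormSq_eq hy]
  field_simp

theorem normSqV_eq (hy : y ∈ S) (hN : weylNormSq G y ≠ 0) :
    normSqV G' y = (Real.exp (2 * u y))⁻¹ * (normSqV G y
      + 2 * ∑ m, gradient G u m y * oneFormV G m y + ∑ m, gradient G u m y * pd m u y) := by
  unfold normSqV
  simp_rw [h.oneFormV_eq hy hN, h.invMetric_eq hy]
  have e : ∑ m, gradient G u m y * oneFormV G m y =
      ∑ a, ∑ b, invMetric G y a b * oneFormV G a y * pd b u y := by
    unfold gradient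
    simp_rw [Finset.sum_mul]
    refine Finset.sum_congr rfl fun b _ => Finset.sum_congr rfl fun c _ => ?_
    ring
  have e' : ∑ m, gradient G u m y * oneFormV G m y =
      ∑ a, ∑ b, invMetric G y a b * pd a u y * oneFormV G b y := by
    rw [e, Finset.sum_comm]
    refine Finset.sum_congr rfl fun b _ => Finset.sum_congr rfl fun c _ => ?_
    rw [h.metric.inv_symm hy]
    ring
  have e2 : ∑ m, gradient G u m y * pd m u y =
      ∑ a, ∑ b, invMetric G y a b * pd a u y * pd b u y := by
    unfold gradient
    simp_rw [Finset.sum_mul]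
    refine Finset.sum_congr rfl fun b _ => Finset.sum_congr rfl fun c _ => ?_
    ring
  have e3 : 2 * ∑ m, gradient G u m y * oneFormV G m y =
      ∑ a, ∑ b, invMetric G y a b * oneFormV G a y * pd b u y +
      ∑ a, ∑ b, invMetric G y a b * pd a u y * oneFormV G b y := by linarith
  rw [e3, e2]
  simp_rw [← Finset.sum_add_distrib, Finset.mul_sum]
  refine Finset.sum_congr rfl fun b _ => Finset.sum_congr rfl fun c _ => ?_
  ring

theorem nablaV_eq (hN : ∀ z ∈ S, weylNormSq G z ≠ 0) (hy : y ∈ S) (a b : Fin 4) :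
    nablaV G' a b y = nablaV G a b y + pd a (pd b u) y
      - ∑ m, christoffel G m a b y * pd m u y
      - (oneFormV G a y + pd a u y) * pd b u y - (oneFormV G b y + pd b u y) * pd a u y
      + (∑ m, gradient G u m y * oneFormV G m y + ∑ m, gradient G u m y * pd m u y) * G y a b := by
  have h1 := (h.metric.smooth_oneFormV hN b).differentiableAt_of_isOpen h.metric.isOpen hy
  have h2 := (h.smooth_pd b).differentiableAt_of_isOpen h.metric.isOpen hy
  have e : ∑ m, christoffel G' m a b y * oneFormV G' m y =
      ∑ m, (oneFormV G m y + pd m u y) * christoffel G' m a b y := by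
    refine Finset.sum_congr rfl fun m _ => ?_
    rw [h.oneFormV_eq hy (hN y hy), mul_comm]
  unfold nablaV
  rw [pd_congr_on a h.metric.isOpen hy fun z hz => h.oneFormV_eq hz (hN z hz) b, pd_add a h1 h2, e,
    h.sum_mul_christoffel hy (fun m => oneFormV G m y + pd m u y)]
  simp only [Fin.sum_univ_four]
  ring

/-- The Hessian of `u` cancels between `P` and `∇V`. The products `∂_a u ∂_b u` occur with
coefficients `1`, `-2`, `1` from `P`, `∇V` and `V ⊗ V`; the mixed products of `V` and `du` and the
multiples of `G` cancel likewise. -/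
theorem tensorT_eq (hN : ∀ z ∈ S, weylNormSq G z ≠ 0) (hy : y ∈ S) (a b : Fin 4) :
    tensorT G' a b y = tensorT G a b y := by
  have hE := Real.exp_ne_zero (2 * u y)
  unfold tensorT
  rw [h.schouten_eq hy, h.nablaV_eq hN hy, h.oneFormV_eq hy (hN y hy), h.oneFormV_eq hy (hN y hy),
    h.normSqV_eq hy (hN y hy), h.eq y hy]
  unfold schoutenChange
  field_simp
  ring

theorem oneFormV_of_ricci_eq_zero
    (hR : ∀ z ∈ S, ∀ a b, ricci G' a b z = 0) (hy : y ∈ S) (a : Fin 4) :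
    oneFormV G' a y = 0 := by
  unfold oneFormV
  simp [h.metric'.divWeyl_of_ricci_eq_zero hR hy]

/-- The tensor `T` of a metric with nonvanishing Weyl tensor vanishes if the metric is conformal to
a Ricci-flat one. -/
theorem tensorT_eq_zero_of_ricci_eq_zero (hN : ∀ z ∈ S, weylNormSq G z ≠ 0)
    (hR : ∀ z ∈ S, ∀ a b, ricci G' a b z = 0) (hy : y ∈ S) (a b : Fin 4) :
    tensorT G a b y = 0 := by
  have hV := fun z hz => h.oneFormV_of_ricci_eq_zero hR (y := z) hz
  rw [← h.tensorT_eq hN hy]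
  unfold tensorT nablaV normSqV
  rw [pd_congr_on a h.metric.isOpen hy fun z hz => hV z hz b, pd_const]
  simp [hV y hy, schouten, scalarCurv, hR y hy]

/-- The one-form and the Weyl divergence of `G'` vanish, so for `G` both are contractions with
`-∇u`. The quadratic identity then gives `|div C|² = ¼ |C|² |∇u|²`, and `|V|² = |∇u|²`. -/
theorem scalarInvariant_eq_zero_of_ricci_eq_zero (hN : ∀ z ∈ S, weylNormSq G z ≠ 0)
    (hR : ∀ z ∈ S, ∀ a b, ricci G' a b z = 0) (hy : y ∈ S) : scalarInvariant G y = 0 := by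
  have hV : ∀ a, oneFormV G a y = - pd a u y := fun a => by
    have h1 := h.oneFormV_of_ricci_eq_zero hR hy a
    rw [h.oneFormV_eq hy (hN y hy)] at h1
    linarith
  have hD : ∀ b c d, divWeyl G b c d y = - ∑ m, gradient G u m y * weyl G b c d m y :=
    fun b c d => by
      have h1 := h.metric'.divWeyl_of_ricci_eq_zero hR hy b c d
      rw [h.divWeyl_eq hy] at h1
      linarith
  have hDU : ∀ b c d, divWeylUp G b c d y = - ∑ m, gradient G u m y * weylUp G b c d m y :=
    fun b c d => by
      unfold divWeylUp weylUp
      simp_rw [hD, mul_neg, Finset.sum_neg_distrib, Finset.mul_sum]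
      rw [sum_comm_triple_single]
      congr 1
      refine Finset.sum_congr rfl fun m _ => Finset.sum_congr rfl fun b _ =>
        Finset.sum_congr rfl fun c _ => Finset.sum_congr rfl fun d _ => ?_
      ring
  have hV2 : normSqV G y = ∑ a, gradient G u a y * pd a u y := by
    unfold normSqV gradient
    simp_rw [hV, Finset.sum_mul]
    refine Finset.sum_congr rfl fun b _ => Finset.sum_congr rfl fun c _ => ?_
    ring
  have hDD : ∑ b, ∑ c, ∑ d, divWeyl G b c d y * divWeylUp G b c d y =
      ∑ a, gradient G u a y * ∑ b, ∑ c, ∑ d, weylUp G b c d a y *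
        ∑ m, gradient G u m y * weyl G b c d m y := by
    have e : ∑ a, gradient G u a y * ∑ b, ∑ c, ∑ d, weylUp G b c d a y *
          ∑ m, gradient G u m y * weyl G b c d m y = ∑ b, ∑ c, ∑ d, ∑ a, gradient G u a y *
          (weylUp G b c d a y * ∑ m, gradient G u m y * weyl G b c d m y) := by
      rw [sum_comm_triple_single]
      refine Finset.sum_congr rfl fun a _ => ?_
      rw [Finset.mul_sum]
      refine Finset.sum_congr rfl fun b _ => ?_
      rw [Finset.mul_sum]
      refine Finset.sum_congr rfl fun c _ => ?_
      rw [Finset.mul_sum]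
    rw [e]
    refine Finset.sum_congr rfl fun b _ => Finset.sum_congr rfl fun c _ =>
        Finset.sum_congr rfl fun d _ => ?_
    rw [hD, hDU, neg_mul_neg, mul_comm, Finset.sum_mul]
    exact Finset.sum_congr rfl fun a _ => by ring
  unfold scalarInvariant
  rw [hDD, hV2]
  simp_rw [h.metric.weylUp_contract_sum hy (fun m => gradient G u m y), h.lower_gradient hy]
  simp only [Fin.sum_univ_four]
  ring

/-- If `T` vanishes and the one-form `V` is `-d u`, then `exp (2 u) G` is Ricci-flat. -/
theorem ricci_eq_zero_of_tensorT_eq_zero (hN : ∀ z ∈ S, weylNormSq G z ≠ 0)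
    (hT : ∀ z ∈ S, ∀ a b, tensorT G a b z = 0) (hV : ∀ z ∈ S, ∀ a, oneFormV G a z = - pd a u z)
    (hy : y ∈ S) (a b : Fin 4) : ricci G' a b y = 0 := by
  have hV' : ∀ z ∈ S, ∀ a, oneFormV G' a z = 0 := fun z hz a => by
    rw [h.oneFormV_eq hz (hN z hz), hV z hz]; ring
  -- As `V` of `G'` vanishes on all of `S`, so does its derivative, and the invariant tensor `T` is
  -- the Schouten tensor of `G'`.
  refine h.metric'.ricci_eq_zero_of_schouten_eq_zero hy (fun a b => ?_) a b
  have h1 := hT y hy a b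
  rw [← h.tensorT_eq hN hy] at h1
  unfold tensorT nablaV normSqV at h1
  rw [pd_congr_on a h.metric.isOpen hy fun z hz => hV' z hz b, pd_const] at h1
  simpa [hV' y hy] using h1

end IsConformalOn

/-- All terms of `T_{ab}` except `∂_a V_b` are symmetric, so the antisymmetric part of `T` is that
of `∂_a V_b`, that is, `dV` up to a factor. -/
theorem IsMetricOn.pd_oneFormV_symm {G : MetricField} {S : Set R4} {y : R4} (hG : IsMetricOn G S)
    (hy : y ∈ S) (hT : ∀ a b, tensorT G a b y = 0) (a b : Fin 4) :
    pd a (oneFormV G b) y = pd b (oneFormV G a) y := by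
  have h1 := hT a b
  have h2 := hT b a
  unfold tensorT nablaV at h1 h2
  simp_rw [hG.christoffel_symm hy _ b a, hG.schouten_symm hy b a, hG.symm y hy b a] at h2
  linarith


/-! ### Behaviour of the connection and the curvature under coordinate changes. -/

/-- The Jacobian matrix `∂_a τ^k` of a coordinate change. -/
def jacobian (τ : R4 → R4) (k a : Fin 4) (y : R4) : ℝ := pd a (fun z => τ z k) y

theorem pd_comp {τ : R4 → R4} {f : R4 → ℝ} {y : R4} (a : Fin 4) (hf : DifferentiableAt ℝ f (τ y))
    (hτ : DifferentiableAt ℝ τ y) :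
    pd a (fun z => f (τ z)) y = ∑ p, jacobian τ p a y * pd p f (τ y) := by
  have h : fderiv ℝ (fun z => f (τ z)) y = (fderiv ℝ f (τ y)).comp (fderiv ℝ τ y) :=
    fderiv_comp y hf hτ
  unfold pd jacobian pd
  rw [h, ContinuousLinearMap.comp_apply, fderiv_apply_eq_sum_pd]
  refine Finset.sum_congr rfl fun p _ => ?_
  have h2 : fderiv ℝ (fun z => τ z p) y = (EuclideanSpace.proj p).comp (fderiv ℝ τ y) :=
    (((EuclideanSpace.proj (𝕜 := ℝ) p).hasFDerivAt).comp y hτ.hasFDerivAt).fderiv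
  rw [h2]
  rfl

/-- On `S'`, the field `G'` is the pullback of the metric `G` along the coordinate change `τ`. -/
structure IsPullbackOn (G G' : MetricField) (τ : R4 → R4) (S S' : Set R4) : Prop where
  metric : IsMetricOn G S
  metric' : IsMetricOn G' S'
  smooth : ContDiffOn ℝ ∞ τ S'
  mapsTo : Set.MapsTo τ S' S
  eq : ∀ y ∈ S', ∀ a b, G' y a b = ∑ m, ∑ n, jacobian τ m a y * jacobian τ n b y * G (τ y) m n

/-- The Christoffel symbols `J^m_a Γ^k_{mn}` of the pulled back connection. -/
def pullbackChristoffel (G : MetricField) (τ : R4 → R4) (a k n : Fin 4) (y : R4) : ℝ :=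
  ∑ m, jacobian τ m a y * christoffel G k m n (τ y)

namespace IsPullbackOn
variable {G G' : MetricField} {τ : R4 → R4} {S S' : Set R4} {y : R4}
  (h : IsPullbackOn G G' τ S S')
include h

theorem smooth_coord (k : Fin 4) : ContDiffOn ℝ ∞ (fun z => τ z k) S' := by
  have := h.smooth
  fun_prop

theorem smooth_jacobian (k a : Fin 4) : ContDiffOn ℝ ∞ (jacobian τ k a) S' :=
  contDiffOn_pd a h.metric'.isOpen (h.smooth_coord k)

theorem differentiableAt (hy : y ∈ S') : DifferentiableAt ℝ τ y :=
  (h.smooth.contDiffAt (h.metric'.isOpen.mem_nhds hy)).differentiableAt (by simp)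

theorem pd_jacobian_symm (hy : y ∈ S') (k a b : Fin 4) :
    pd a (jacobian τ k b) y = pd b (jacobian τ k a) y :=
  pd_comm a b h.metric'.isOpen (h.smooth_coord k) hy

theorem eq_mul (hy : y ∈ S') :
    G' y = (Matrix.of fun k a => jacobian τ k a y).transpose * G (τ y)
      * Matrix.of fun k a => jacobian τ k a y := by
  ext a b
  rw [h.eq y hy]
  simp only [Matrix.mul_apply, Matrix.transpose_apply, Matrix.of_apply, Finset.sum_mul]
  rw [Finset.sum_comm]
  refine Finset.sum_congr rfl fun n _ => Finset.sum_congr rfl fun m _ => ?_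
  ring

/-- Nondegeneracy of the pulled back metric forces the Jacobian to be invertible, so `τ` need not be
assumed a diffeomorphism. -/
theorem det_jacobian_ne_zero (hy : y ∈ S') :
    (Matrix.of fun k a => jacobian τ k a y).det ≠ 0 := by
  have h1 := h.metric'.det_ne_zero hy
  rw [h.eq_mul hy, Matrix.det_mul] at h1
  exact right_ne_zero_of_mul h1

theorem pd_metric' (hy : y ∈ S') (a b c : Fin 4) :
    pd a (fun z => G' z b c) y =
      ∑ m, ∑ n, (pd a (jacobian τ m b) y * jacobian τ n c y * G (τ y) m n
        + jacobian τ m b y * pd a (jacobian τ n c) y * G (τ y) m n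
        + jacobian τ m b y * jacobian τ n c y *
          ∑ p, jacobian τ p a y * pd p (fun z => G z m n) (τ y)) := by
  have h1 : ∀ k a, DifferentiableAt ℝ (jacobian τ k a) y := fun k a =>
    (h.smooth_jacobian k a).differentiableAt_of_isOpen h.metric'.isOpen hy
  have h2 : ∀ m n, DifferentiableAt ℝ (fun z => G z m n) (τ y) := fun m n =>
    (h.metric.smooth m n).differentiableAt_of_isOpen h.metric.isOpen (h.mapsTo hy)
  have h3 : ∀ m n, DifferentiableAt ℝ (fun z => G (τ z) m n) y := fun m n =>
    (h2 m n).comp y (h.differentiableAt hy)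
  have h4 : ∀ m n, DifferentiableAt ℝ
      (fun z => jacobian τ m b z * jacobian τ n c z * G (τ z) m n) y := fun m n =>
    ((h1 _ _).mul (h1 _ _)).mul (h3 m n)
  rw [pd_congr_on a h.metric'.isOpen hy fun z hz => h.eq z hz b c, pd_sum a (by fun_prop)]
  refine Finset.sum_congr rfl fun m _ => ?_
  rw [pd_sum a (h4 m)]
  refine Finset.sum_congr rfl fun n _ => ?_
  rw [pd_mul a (by fun_prop) (h3 m n), pd_mul a (h1 _ _) (h1 _ _),
    pd_comp a (f := fun z => G z m n) (h2 m n) (h.differentiableAt hy)]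
  ring

/-- The inhomogeneous transformation law of the connection. Both sides are lowered with `Jᵀ G` and
evaluated by the formula for the Christoffel symbols of the first kind; `H` collects the second
derivatives of `τ`, and `D` the derivatives of `G`. -/
theorem jacobian_mul_christoffel (hy : y ∈ S') (k a b : Fin 4) :
    ∑ c, jacobian τ k c y * christoffel G' c a b y =
      pd a (jacobian τ k b) y + ∑ n, pullbackChristoffel G τ a k n y * jacobian τ n b y := by
  obtain ⟨H, hH⟩ : ∃ H : Fin 4 → Fin 4 → Fin 4 → ℝ, ∀ a b c,
      ∑ m, ∑ n, pd a (jacobian τ m b) y * jacobian τ n c y * G (τ y) m n = H a b c :=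
    ⟨_, fun _ _ _ => rfl⟩
  obtain ⟨D, hD⟩ : ∃ D : Fin 4 → Fin 4 → Fin 4 → ℝ, ∀ a b c,
      ∑ m, ∑ n, ∑ p, jacobian τ p a y * jacobian τ m b y * jacobian τ n c y *
        pd p (fun z => G z m n) (τ y) = D a b c :=
    ⟨_, fun _ _ _ => rfl⟩
  have hHs : ∀ a b c, H a b c = H b a c := fun a b c => by
    simp_rw [← hH, h.pd_jacobian_symm hy _ a b]
  have hs := h.metric.symm (τ y) (h.mapsTo hy)
  have hg : ∀ a b c, pd a (fun z => G' z b c) y = H a b c + H a c b + D a b c := by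
    intro a b c
    have e : H a c b = ∑ m, ∑ n, jacobian τ m b y * pd a (jacobian τ n c) y * G (τ y) m n := by
      rw [← hH, Finset.sum_comm]
      refine Finset.sum_congr rfl fun n _ => Finset.sum_congr rfl fun m _ => ?_
      rw [hs]; ring
    rw [h.pd_metric' hy, e, ← hH, ← hD]
    simp_rw [← Finset.sum_add_distrib, Finset.mul_sum]
    refine Finset.sum_congr rfl fun n _ => Finset.sum_congr rfl fun m _ => ?_
    congr 1
    exact Finset.sum_congr rfl fun p _ => by ring
  have hL : ∀ c, ∑ l, ∑ k, jacobian τ l c y * G (τ y) l k *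
      ∑ e, jacobian τ k e y * christoffel G' e a b y =
      H a b c + 1 / 2 * (D a b c + D b a c - D c a b) := by
    intro c
    have e : ∑ l, ∑ k, jacobian τ l c y * G (τ y) l k *
        ∑ e, jacobian τ k e y * christoffel G' e a b y =
        ∑ e, G' y c e * christoffel G' e a b y := by
      simp_rw [h.eq y hy, Finset.mul_sum, Finset.sum_mul]
      conv_rhs => rw [Finset.sum_comm]
      refine Finset.sum_congr rfl fun l _ => ?_
      rw [Finset.sum_comm]
      refine Finset.sum_congr rfl fun l _ => Finset.sum_congr rfl fun m _ => ?_
      ring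
    rw [e, h.metric'.lower_christoffel hy, hg, hg, hg, hHs a c b, hHs b c a, hHs b a c]
    ring
  have hR : ∀ c, ∑ l, ∑ k, jacobian τ l c y * G (τ y) l k *
      (pd a (jacobian τ k b) y + ∑ n, pullbackChristoffel G τ a k n y * jacobian τ n b y) =
      H a b c + 1 / 2 * (D a b c + D b a c - D c a b) := by
    intro c
    have e1 : ∑ l, ∑ k, jacobian τ l c y * G (τ y) l k * pd a (jacobian τ k b) y = H a b c := by
      rw [← hH, Finset.sum_comm]
      refine Finset.sum_congr rfl fun n _ => Finset.sum_congr rfl fun m _ => ?_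
      rw [hs]; ring
    have e2 : ∑ l, ∑ k, jacobian τ l c y * G (τ y) l k *
        ∑ n, pullbackChristoffel G τ a k n y * jacobian τ n b y =
        ∑ l, ∑ m, ∑ n, jacobian τ l c y * jacobian τ m a y * jacobian τ n b y *
          ∑ k, G (τ y) l k * christoffel G k m n (τ y) := by
      refine Finset.sum_congr rfl fun l _ => ?_
      unfold pullbackChristoffel
      simp_rw [Finset.sum_mul, Finset.mul_sum]
      rw [sum_rev_triple]
      refine Finset.sum_congr rfl fun l _ => Finset.sum_congr rfl fun m _ =>
        Finset.sum_congr rfl fun m _ => ?_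
      ring
    have d1 : D a b c = ∑ l, ∑ m, ∑ n, jacobian τ l c y * jacobian τ m a y * jacobian τ n b y *
        pd m (fun z => G z n l) (τ y) := by
      rw [← hD, sum_rev_triple, Finset.sum_comm]
      refine Finset.sum_congr rfl fun l _ => Finset.sum_congr rfl fun m _ =>
        Finset.sum_congr rfl fun m _ => ?_
      ring
    have d2 : D b a c = ∑ l, ∑ m, ∑ n, jacobian τ l c y * jacobian τ m a y * jacobian τ n b y *
        pd n (fun z => G z m l) (τ y) := by
      rw [← hD, Finset.sum_comm]
      refine Finset.sum_congr rfl fun l _ => Finset.sum_congr rfl fun m _ =>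
        Finset.sum_congr rfl fun m _ => ?_
      ring
    have d3 : D c a b = ∑ l, ∑ m, ∑ n, jacobian τ l c y * jacobian τ m a y * jacobian τ n b y *
        pd l (fun z => G z m n) (τ y) := by
      rw [← hD, sum_rev_triple]
      refine Finset.sum_congr rfl fun l _ => ?_
      rw [Finset.sum_comm]
    simp_rw [mul_add, Finset.sum_add_distrib]
    rw [e1, e2, d1, d2, d3]
    simp_rw [h.metric.lower_christoffel (h.mapsTo hy), ← Finset.sum_add_distrib,
      ← Finset.sum_sub_distrib, Finset.mul_sum]
    congr 1
    refine Finset.sum_congr rfl fun l _ => Finset.sum_congr rfl fun m _ =>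
      Finset.sum_congr rfl fun m _ => ?_
    ring
  -- The matrix `Jᵀ G` used for lowering is invertible, so it can be removed again.
  have hdet : ((Matrix.of fun k a => jacobian τ k a y).transpose * G (τ y)).det ≠ 0 := by
    have h1 := h.metric'.det_ne_zero hy
    rw [h.eq_mul hy, Matrix.det_mul] at h1
    exact left_ne_zero_of_mul h1
  have hz := Matrix.eq_zero_of_mulVec_eq_zero hdet (v := fun k =>
      ∑ c, jacobian τ k c y * christoffel G' c a b y -
      (pd a (jacobian τ k b) y + ∑ n, pullbackChristoffel G τ a k n y * jacobian τ n b y)) (by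
    ext c
    simp only [Matrix.mulVec, dotProduct, Matrix.mul_apply, Matrix.transpose_apply,
      Matrix.of_apply, Pi.zero_apply]
    have := (hL c).trans (hR c).symm
    rw [← sub_eq_zero] at this
    rw [← this, ← Finset.sum_sub_distrib]
    simp_rw [Finset.sum_mul]
    rw [Finset.sum_comm]
    simp_rw [mul_sub, Finset.sum_sub_distrib])
  exact sub_eq_zero.1 (congrFun hz k)

end IsPullbackOn
namespace IsPullbackOn
variable {G G' : MetricField} {τ : R4 → R4} {S S' : Set R4} {y : R4}
  (h : IsPullbackOn G G' τ S S')
include h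

theorem differentiableAt_jacobian (hy : y ∈ S') (k a : Fin 4) :
    DifferentiableAt ℝ (jacobian τ k a) y :=
  (h.smooth_jacobian k a).differentiableAt_of_isOpen h.metric'.isOpen hy

theorem differentiableAt_christoffel (hy : y ∈ S') (c a b : Fin 4) :
    DifferentiableAt ℝ (christoffel G c a b) (τ y) :=
  (h.metric.smooth_christoffel c a b).differentiableAt_of_isOpen h.metric.isOpen (h.mapsTo hy)

theorem differentiableAt_christoffel_comp (hy : y ∈ S') (c a b : Fin 4) :
    DifferentiableAt ℝ (fun z => christoffel G c a b (τ z)) y :=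
  (h.differentiableAt_christoffel hy c a b).comp y (h.differentiableAt hy)

theorem differentiableAt_pullbackChristoffel (hy : y ∈ S') (a k n : Fin 4) :
    DifferentiableAt ℝ (pullbackChristoffel G τ a k n) y := by
  have h1 := h.differentiableAt_jacobian hy
  have h2 := h.differentiableAt_christoffel_comp hy
  exact DifferentiableAt.fun_sum fun m _ => (h1 _ _).fun_mul (h2 _ _ _)

theorem pd_pullbackChristoffel (hy : y ∈ S') (d a k n : Fin 4) :
    pd d (pullbackChristoffel G τ a k n) y =
      ∑ m, (pd d (jacobian τ m a) y * christoffel G k m n (τ y)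
        + jacobian τ m a y * ∑ p, jacobian τ p d y * pd p (christoffel G k m n) (τ y)) := by
  have h1 := h.differentiableAt_jacobian hy
  have h2 := h.differentiableAt_christoffel_comp hy
  unfold pullbackChristoffel
  rw [pd_sum d fun m => (h1 m a).fun_mul (h2 _ _ _)]
  refine Finset.sum_congr rfl fun m _ => ?_
  rw [pd_mul d (h1 _ _) (h2 _ _ _),
    pd_comp d (h.differentiableAt_christoffel hy _ _ _) (h.differentiableAt hy)]

/-- The curvature of a pulled back connection is the pullback of the curvature: second derivatives
of `τ` are symmetric and drop out of the antisymmetrisation. -/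
theorem curvature_pullbackChristoffel (hy : y ∈ S') (d a k n : Fin 4) :
    pd d (pullbackChristoffel G τ a k n) y - pd a (pullbackChristoffel G τ d k n) y
      + ∑ m, (pullbackChristoffel G τ d k m y * pullbackChristoffel G τ a m n y
        - pullbackChristoffel G τ a k m y * pullbackChristoffel G τ d m n y) =
      ∑ p, ∑ m, jacobian τ p d y * jacobian τ m a y * curvature G p m k n (τ y) := by
  rw [h.pd_pullbackChristoffel hy, h.pd_pullbackChristoffel hy]
  simp_rw [h.pd_jacobian_symm hy _ d a]
  unfold pullbackChristoffel curvature
  simp only [Fin.sum_univ_four]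
  ring

theorem pd_jacobian_mul_christoffel (hy : y ∈ S') (d k a b : Fin 4) :
    ∑ c, (pd d (jacobian τ k c) y * christoffel G' c a b y
        + jacobian τ k c y * pd d (christoffel G' c a b) y) =
      pd d (pd a (jacobian τ k b)) y
        + ∑ n, (pd d (pullbackChristoffel G τ a k n) y * jacobian τ n b y
          + pullbackChristoffel G τ a k n y * pd d (jacobian τ n b) y) := by
  have h1 := h.differentiableAt_jacobian hy
  have h2 := h.differentiableAt_pullbackChristoffel hy
  have h3 : ∀ c a b, DifferentiableAt ℝ (christoffel G' c a b) y := fun c a b =>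
    (h.metric'.smooth_christoffel c a b).differentiableAt_of_isOpen h.metric'.isOpen hy
  have h4 : DifferentiableAt ℝ (pd a (jacobian τ k b)) y :=
    (contDiffOn_pd a h.metric'.isOpen (h.smooth_jacobian k b)).differentiableAt_of_isOpen
      h.metric'.isOpen hy
  have e := pd_congr_on d h.metric'.isOpen hy fun z hz => h.jacobian_mul_christoffel hz k a b
  rw [pd_sum d fun c => (h1 k c).fun_mul (h3 c a b),
    pd_add d h4 (DifferentiableAt.fun_sum fun n _ => (h2 a k n).fun_mul (h1 n b)),
    pd_sum d fun n => (h2 a k n).fun_mul (h1 n b)] at e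
  rw [Finset.sum_congr rfl fun c _ => pd_mul d (h1 k c) (h3 c a b),
    Finset.sum_congr rfl fun n _ => pd_mul d (h2 a k n) (h1 n b)] at e
  exact e

theorem jacobian_mul_christoffel_mul_christoffel (hy : y ∈ S') (k d a b : Fin 4) :
    ∑ c, jacobian τ k c y * ∑ e, christoffel G' c d e y * christoffel G' e a b y =
      ∑ c, pd d (jacobian τ k c) y * christoffel G' c a b y
      + ∑ n, pullbackChristoffel G τ d k n y * pd a (jacobian τ n b) y
      + ∑ m, (∑ n, pullbackChristoffel G τ d k n y * pullbackChristoffel G τ a n m y)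
        * jacobian τ m b y := by
  have e1 : ∑ c, jacobian τ k c y * ∑ e, christoffel G' c d e y * christoffel G' e a b y =
      ∑ e, (∑ c, jacobian τ k c y * christoffel G' c d e y) * christoffel G' e a b y := by
    simp only [Fin.sum_univ_four]; ring
  have e2 : ∑ e, (∑ n, pullbackChristoffel G τ d k n y * jacobian τ n e y)
      * christoffel G' e a b y = ∑ n, pullbackChristoffel G τ d k n y *
        ∑ e, jacobian τ n e y * christoffel G' e a b y := by
    simp only [Fin.sum_univ_four]; ring
  rw [e1]
  simp_rw [h.jacobian_mul_christoffel hy k d, add_mul, Finset.sum_add_distrib]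
  rw [e2]
  simp_rw [h.jacobian_mul_christoffel hy _ a b]
  simp only [Fin.sum_univ_four]
  ring

/-- With `A` the pulled back connection, the transformation law reads `J Γ' = ∂J + A J`: the
Jacobian intertwines the two connections, hence their curvatures. Concretely, the law is
differentiated and antisymmetrised, and the third derivatives of `τ` cancel. -/
theorem jacobian_mul_curvature (hy : y ∈ S') (k d a b : Fin 4) :
    ∑ c, jacobian τ k c y * curvature G' d a c b y =
      ∑ n, (∑ p, ∑ m, jacobian τ p d y * jacobian τ m a y * curvature G p m k n (τ y))
        * jacobian τ n b y := by
  have e1 := h.pd_jacobian_mul_christoffel hy d k a b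
  have e2 := h.pd_jacobian_mul_christoffel hy a k d b
  have p1 := h.jacobian_mul_christoffel_mul_christoffel hy k d a b
  have p2 := h.jacobian_mul_christoffel_mul_christoffel hy k a d b
  have c := pd_comm d a h.metric'.isOpen (h.smooth_jacobian k b) hy
  simp_rw [← h.curvature_pullbackChristoffel hy]
  unfold curvature
  simp only [Fin.sum_univ_four] at *
  linear_combination e1 - e2 + p1 - p2 + c

theorem ricci_eq_zero (hy : y ∈ S') (hR : ∀ a b, ricci G a b (τ y) = 0) (a b : Fin 4) :
    ricci G' a b y = 0 := by
  set J : Matrix (Fin 4) (Fin 4) ℝ := Matrix.of fun k a => jacobian τ k a y with hJ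
  have hd : IsUnit J.det := (h.det_jacobian_ne_zero hy).isUnit
  have i1 : ∀ c e, ∑ k, J⁻¹ c k * jacobian τ k e y = if c = e then 1 else 0 := fun c e => by
    have := congrFun (congrFun (Matrix.nonsing_inv_mul J hd) c) e
    simpa [Matrix.mul_apply, Matrix.one_apply, hJ] using this
  have i2 : ∀ p k, ∑ d, jacobian τ p d y * J⁻¹ d k = if p = k then 1 else 0 := fun c e => by
    have := congrFun (congrFun (Matrix.mul_nonsing_inv J hd) c) e
    simpa [Matrix.mul_apply, Matrix.one_apply, hJ] using this
  have hc : ∀ d c, curvature G' d a c b y = ∑ k, J⁻¹ c k *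
      ∑ n, (∑ p, ∑ m, jacobian τ p d y * jacobian τ m a y * curvature G p m k n (τ y))
        * jacobian τ n b y := by
    intro d c
    simp_rw [← h.jacobian_mul_curvature hy, Finset.mul_sum]
    rw [Finset.sum_comm]
    simp_rw [← mul_assoc, ← Finset.sum_mul, i1]
    simp
  unfold ricci
  simp_rw [hc]
  -- In the Ricci trace the inverse Jacobian on the upper index meets the Jacobian on the first
  -- lower index, and they cancel.
  have e : ∑ d, ∑ k, J⁻¹ d k *
      ∑ n, (∑ p, ∑ m, jacobian τ p d y * jacobian τ m a y * curvature G p m k n (τ y))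
        * jacobian τ n b y = ∑ k, ∑ n, ∑ p, ∑ m, (∑ d, jacobian τ p d y * J⁻¹ d k) *
          (jacobian τ m a y * curvature G p m k n (τ y) * jacobian τ n b y) := by
    simp_rw [Finset.sum_mul, Finset.mul_sum]
    rw [sum_comm_single_quad]
    refine Finset.sum_congr rfl fun _ _ => Finset.sum_congr rfl fun _ _ =>
      Finset.sum_congr rfl fun _ _ => Finset.sum_congr rfl fun _ _ =>
      Finset.sum_congr rfl fun _ _ => ?_
    ring
  have e' : ∑ k, ∑ n, ∑ m, jacobian τ m a y * curvature G k m k n (τ y) * jacobian τ n b y =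
      ∑ n, ∑ m, ricci G m n (τ y) * (jacobian τ m a y * jacobian τ n b y) := by
    rw [Finset.sum_comm]
    refine Finset.sum_congr rfl fun n _ => ?_
    rw [Finset.sum_comm]
    unfold ricci
    simp_rw [Finset.sum_mul]
    refine Finset.sum_congr rfl fun _ _ => Finset.sum_congr rfl fun _ _ => ?_
    ring
  rw [e]
  simp_rw [i2, ite_mul, one_mul, zero_mul, Finset.sum_ite_irrel, Finset.sum_const_zero]
  simp only [Finset.sum_ite_eq', Finset.mem_univ, if_true]
  rw [e']
  simp [hR]

end IsPullbackOn

/-! ### The Poincaré lemma. -/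

/-- The Poincaré lemma for smooth one-forms on an open convex set of coordinates. -/
theorem exists_pd_eq_of_pd_symm {V : Fin 4 → R4 → ℝ} {B : Set R4} (hB : IsOpen B)
    (hc : Convex ℝ B) (hV : ∀ a, ContDiffOn ℝ ∞ (V a) B)
    (hs : ∀ y ∈ B, ∀ a b, pd a (V b) y = pd b (V a) y) :
    ∃ f : R4 → ℝ, ContDiffOn ℝ ∞ f B ∧ ∀ y ∈ B, ∀ a, pd a f y = V a y := by
  obtain ⟨P, hP⟩ : ∃ P : Fin 4 → R4 →L[ℝ] ℝ, ∀ a v, P a v = v a :=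
    ⟨fun a => EuclideanSpace.proj a, fun _ _ => rfl⟩
  set θ : R4 → R4 →L[ℝ] ℝ := fun y => ∑ a, V a y • P a with hθ
  have hθ_smooth : ContDiffOn ℝ ∞ θ B :=
    ContDiffOn.sum fun a _ => (hV a).smul contDiffOn_const
  have hd : ∀ y ∈ B, ∀ a, DifferentiableAt ℝ (V a) y := fun y hy a =>
    (hV a).differentiableAt_of_isOpen hB hy
  have hfd : ∀ y ∈ B, ∀ v w, fderiv ℝ θ y v w = ∑ a, ∑ b, v b * w a * pd b (V a) y := by
    intro y hy v w
    have h1 : HasFDerivAt θ (∑ a, (fderiv ℝ (V a) y).smulRight (P a)) y :=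
      HasFDerivAt.fun_sum fun a _ => by exact (hd y hy a).hasFDerivAt.smul_const (P a)
    rw [h1.fderiv]
    simp only [_root_.sum_apply, ContinuousLinearMap.smulRight_apply,
      fderiv_apply_eq_sum_pd]
    refine Finset.sum_congr rfl fun a _ => ?_
    simp [hP, Finset.sum_mul, mul_right_comm]
  obtain ⟨f, hf⟩ := hc.exists_forall_hasFDerivAt_of_fderiv_symmetric hB
    (hθ_smooth.differentiableOn (by simp)) (fun y hy v w => by
      rw [hfd y hy, hfd y hy, Finset.sum_comm]
      refine Finset.sum_congr rfl fun a _ => Finset.sum_congr rfl fun b _ => ?_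
      rw [hs y hy]; ring)
  refine ⟨f, ?_, fun y hy a => ?_⟩
  -- The primitive is smooth because its derivative is the smooth form `θ`.
  · rw [contDiffOn_infty_iff_fderiv_of_isOpen hB]
    exact ⟨fun y hy => (hf y hy).differentiableAt.differentiableWithinAt,
      hθ_smooth.congr fun y hy => (hf y hy).fderiv⟩
  · unfold pd
    rw [(hf y hy).fderiv]
    simp [hθ, hP]

end Coord

/-! ### From coordinates to the manifold. -/

section Manifold

variable {M : Type*} [TopologicalSpace M] [ChartedSpace R4 M] [IsManifold (𝓡 4) ∞ M]
  {e e' : OpenPartialHomeomorph M R4}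

omit [IsManifold (𝓡 4) ∞ M] in
theorem mdifferentiable_of_mem_maximalAtlas (he : e ∈ IsManifold.maximalAtlas (𝓡 4) ∞ M) :
    e.MDifferentiable (𝓡 4) (𝓡 4) :=
  ⟨(contMDiffOn_of_mem_maximalAtlas he).mdifferentiableOn (by simp),
    (contMDiffOn_symm_of_mem_maximalAtlas he).mdifferentiableOn (by simp)⟩

omit [IsManifold (𝓡 4) ∞ M] in
theorem mfderiv_symm_eq_sum_coordVector (y : R4) (v : R4) :
    (mfderiv (𝓡 4) (𝓡 4) e.symm y v : TangentSpace (𝓡 4) (e.symm y)) =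
      ∑ a, v a • coordVector e y a := by
  have hv : v = ∑ a, v a • (EuclideanSpace.single a (1 : ℝ) : R4) := by
    conv_lhs => rw [← (EuclideanSpace.basisFun (Fin 4) ℝ).sum_repr v]
    simp
  unfold coordVector
  conv_lhs => rw [hv]
  exact (map_sum (mfderiv (𝓡 4) (𝓡 4) e.symm y) _ _).trans
    (Finset.sum_congr rfl fun a _ => map_smul (mfderiv (𝓡 4) (𝓡 4) e.symm y) _ _)

/-- The coordinate field is the image of a constant section under the tangent map of the inverse
chart. -/
theorem contMDiffOn_coordVector (he : e ∈ IsManifold.maximalAtlas (𝓡 4) ∞ M) (a : Fin 4) :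
    ContMDiffOn (𝓡 4) (𝓡 4).tangent ∞
      (fun y => (⟨e.symm y, coordVector e y a⟩ : TangentBundle (𝓡 4) M)) e.target := by
  have h1 := (contMDiffOn_symm_of_mem_maximalAtlas he).contMDiffOn_tangentMapWithin
    (m := ∞) (by simp) e.open_target.uniqueMDiffOn
  have h2 : ContMDiffOn (𝓡 4) (𝓡 4).tangent ∞
      (fun y : R4 => (⟨y, (EuclideanSpace.single a (1 : ℝ) : R4)⟩ : TangentBundle (𝓡 4) R4))
      e.target :=
    contMDiffOn_vectorSpace_iff_contDiffOn.2 contDiffOn_const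
  refine (h1.comp h2 fun y hy => hy).congr fun y hy => ?_
  simp only [Function.comp_apply, tangentMapWithin, coordVector]
  rw [mfderivWithin_of_isOpen e.open_target hy]

theorem isMetricOn_components (g : RiemannianMetric4 M)
    (he : e ∈ IsManifold.maximalAtlas (𝓡 4) ∞ M) :
    Coord.IsMetricOn (components g.inner e) e.target where
  isOpen := e.open_target
  smooth a b := by
    have h1 : ContMDiffOn (𝓡 4) ((𝓡 4).prod 𝓘(ℝ)) ∞ (fun y =>
        Bundle.TotalSpace.mk' ℝ (E := Bundle.Trivial M ℝ) (e.symm y)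
          (g.inner (e.symm y) (coordVector e y a) (coordVector e y b))) e.target := by
      apply ContMDiffOn.clm_bundle_apply₂ (F₁ := R4) (F₂ := R4)
      · exact g.contMDiff.comp_contMDiffOn (contMDiffOn_symm_of_mem_maximalAtlas he)
      · exact contMDiffOn_coordVector he a
      · exact contMDiffOn_coordVector he b
    have h2 : ContMDiffOn (𝓡 4) 𝓘(ℝ) ∞ (fun y =>
        g.inner (e.symm y) (coordVector e y a) (coordVector e y b)) e.target := fun y hy => by
      have := h1 y hy
      simp only [Bundle.contMDiffWithinAt_totalSpace] at this
      exact this.2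
    exact h2.contDiffOn
  symm y _ a b := g.symm _ _ _
  posDef y hy := by
    refine Matrix.PosDef.of_dotProduct_mulVec_pos ?_ fun x hx => ?_
    · ext a b
      exact g.symm _ _ _
    · set w : TangentSpace (𝓡 4) (e.symm y) := ∑ a, x a • coordVector e y a with hw
      -- The derivative of the inverse chart is injective, so the coordinate vectors are linearly
      -- independent.
      have hne : w ≠ 0 := by
        intro h0
        rw [hw, ← mfderiv_symm_eq_sum_coordVector (e := e) y (WithLp.toLp 2 x)] at h0
        have hinj := (mdifferentiable_of_mem_maximalAtlas he).symm.mfderiv_injective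
          (x := y) (by simpa using hy)
        have := hinj (h0.trans (map_zero (mfderiv (𝓡 4) (𝓡 4) e.symm y)).symm)
        exact hx (by ext i; exact congrArg (fun v : R4 => v i) this)
      have hpos := g.pos (e.symm y) w hne
      have e1 : g.inner (e.symm y) w w = dotProduct (star x)
          (Matrix.mulVec (components g.inner e y) x) := by
        simp only [hw, map_sum, map_smul, _root_.sum_apply,
          _root_.smul_apply, dotProduct, Matrix.mulVec, components, Matrix.of_apply,
          smul_eq_mul, Finset.mul_sum, Pi.star_apply, star_trivial]
        rw [Finset.sum_comm]
        refine Finset.sum_congr rfl fun a _ => Finset.sum_congr rfl fun b _ => ?_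
        ring
      rwa [e1] at hpos

variable {U : Set M} {Ω : M → ℝ}

theorem IsConformalFactorOn.isConformalOn (hΩ : IsConformalFactorOn Ω U) (hU : IsOpen U)
    (g : RiemannianMetric4 M) (he : e ∈ IsManifold.maximalAtlas (𝓡 4) ∞ M) :
    Coord.IsConformalOn (components g.inner e) (components (conformalMetric Ω g) e)
      (fun y => Real.log (Ω (e.symm y))) (e.target ∩ e.symm ⁻¹' U) := by
  have hS : IsOpen (e.target ∩ e.symm ⁻¹' U) := e.isOpen_inter_preimage_symm hU
  have hg := isMetricOn_components g he
  refine ⟨⟨hS, fun a b => (hg.smooth a b).mono Set.inter_subset_left, fun y hy => hg.symm y hy.1,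
    fun y hy => hg.posDef y hy.1⟩, ?_, fun y hy a b => ?_⟩
  · have h1 : ContMDiffOn (𝓡 4) 𝓘(ℝ, ℝ) ∞ (fun y => Ω (e.symm y)) (e.target ∩ e.symm ⁻¹' U) :=
      hΩ.1.comp ((contMDiffOn_symm_of_mem_maximalAtlas he).mono Set.inter_subset_left)
        fun y hy => hy.2
    exact h1.contDiffOn.log fun y hy => (hΩ.2 _ hy.2).ne'
  · have hp := hΩ.2 _ hy.2
    have h2 : Real.exp (2 * Real.log (Ω (e.symm y))) = Ω (e.symm y) ^ 2 := by
      rw [two_mul, Real.exp_add, Real.exp_log hp, sq]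
    rw [h2]
    rfl

theorem weylNormSq_ne_zero_of_weylNowhereZero {g : RiemannianMetric4 M} (hC : WeylNowhereZero g)
    (he : e ∈ IsManifold.maximalAtlas (𝓡 4) ∞ M) :
    ∀ z ∈ e.target ∩ e.symm ⁻¹' U, Coord.weylNormSq (components g.inner e) z ≠ 0 := fun z hz =>
  (isMetricOn_components g he).weylNormSq_ne_zero hz.1 (hC e he z hz.1)

/-- The coordinate change from the chart `e'` to the chart `e`. -/
abbrev transition (e e' : OpenPartialHomeomorph M R4) (y : R4) : R4 := e (e'.symm y)

omit [ChartedSpace R4 M] [IsManifold (𝓡 4) ∞ M] in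
theorem isOpen_preimage_symm_source :
    IsOpen (e'.target ∩ e'.symm ⁻¹' e.source) :=
  e'.isOpen_inter_preimage_symm e.open_source

omit [IsManifold (𝓡 4) ∞ M] in
theorem contDiffOn_transition (he : e ∈ IsManifold.maximalAtlas (𝓡 4) ∞ M)
    (he' : e' ∈ IsManifold.maximalAtlas (𝓡 4) ∞ M) :
    ContDiffOn ℝ ∞ (transition e e') (e'.target ∩ e'.symm ⁻¹' e.source) :=
  ((contMDiffOn_of_mem_maximalAtlas he).comp
    ((contMDiffOn_symm_of_mem_maximalAtlas he').mono Set.inter_subset_left)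
    fun _ hy => hy.2).contDiffOn

omit [IsManifold (𝓡 4) ∞ M] in
-- The chain rule for `e'.symm = e.symm ∘ transition e e'`. The two base points are equal only
-- propositionally, so the vectors are compared in the common model space `R4`.
theorem coordVector_transition (he : e ∈ IsManifold.maximalAtlas (𝓡 4) ∞ M)
    (he' : e' ∈ IsManifold.maximalAtlas (𝓡 4) ∞ M) {y : R4}
    (hy : y ∈ e'.target ∩ e'.symm ⁻¹' e.source) (a : Fin 4) :
    (coordVector e' y a : R4) = ∑ m, Coord.jacobian (transition e e') m a y •
      (coordVector e (transition e e' y) m : R4) := by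
  have hd : DifferentiableAt ℝ (transition e e') y :=
    ((contDiffOn_transition he he').contDiffAt
      (isOpen_preimage_symm_source.mem_nhds hy)).differentiableAt (by simp)
  have ht : transition e e' y ∈ e.target := e.map_source hy.2
  have h1 : mfderiv (𝓡 4) (𝓡 4) e'.symm y = mfderiv (𝓡 4) (𝓡 4) (e.symm ∘ transition e e') y := by
    refine Filter.EventuallyEq.mfderiv_eq ?_
    filter_upwards [isOpen_preimage_symm_source.mem_nhds hy] with z hz
    exact (e.left_inv hz.2).symm
  have h2 : mfderiv (𝓡 4) (𝓡 4) (e.symm ∘ transition e e') y =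
      (mfderiv (𝓡 4) (𝓡 4) e.symm (transition e e' y)).comp (fderiv ℝ (transition e e') y) := by
    rw [mfderiv_comp (I' := 𝓡 4) y
      ((mdifferentiable_of_mem_maximalAtlas he).mdifferentiableAt_symm ht)
      hd.mdifferentiableAt, mfderiv_eq_fderiv]
    rfl
  have h3 : (coordVector e' y a : R4) = mfderiv (𝓡 4) (𝓡 4) e.symm (transition e e' y)
      (fderiv ℝ (transition e e') y (EuclideanSpace.single a (1 : ℝ))) := by
    unfold coordVector
    exact congrArg (fun L : R4 →L[ℝ] R4 => L (EuclideanSpace.single a (1 : ℝ))) (h1.trans h2)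
  rw [h3]
  refine (mfderiv_symm_eq_sum_coordVector (e := e) (transition e e' y) _).trans ?_
  refine Finset.sum_congr rfl fun m _ => ?_
  congr 1
  have h4 : fderiv ℝ (fun z => transition e e' z m) y =
      (EuclideanSpace.proj m).comp (fderiv ℝ (transition e e') y) :=
    (((EuclideanSpace.proj (𝕜 := ℝ) m).hasFDerivAt).comp y hd.hasFDerivAt).fderiv
  unfold Coord.jacobian Coord.pd
  rw [h4]
  rfl

omit [IsManifold (𝓡 4) ∞ M] in
-- Transport between tangent spaces at equal base points, both of which unfold to `R4`.
theorem bilinear_field_congr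
    (h : ∀ x : M, TangentSpace (𝓡 4) x →L[ℝ] TangentSpace (𝓡 4) x →L[ℝ] ℝ) {x x' : M}
    (hx : x = x') (v w : R4) :
    h x (v : TangentSpace (𝓡 4) x) (w : TangentSpace (𝓡 4) x) =
      h x' (v : TangentSpace (𝓡 4) x') (w : TangentSpace (𝓡 4) x') := by
  subst hx; rfl

theorem bilinear_apply_sum (B : R4 →L[ℝ] R4 →L[ℝ] ℝ) (c d : Fin 4 → ℝ) (v w : Fin 4 → R4) :
    B (∑ m, c m • v m) (∑ n, d n • w n) = ∑ m, ∑ n, c m * d n * B (v m) (w n) := by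
  simp only [map_sum, map_smul, _root_.sum_apply, _root_.smul_apply, smul_eq_mul, Finset.mul_sum]
  rw [Finset.sum_comm]
  refine Finset.sum_congr rfl fun m _ => Finset.sum_congr rfl fun n _ => ?_
  ring

omit [IsManifold (𝓡 4) ∞ M] in
theorem components_transition
    (h : ∀ x : M, TangentSpace (𝓡 4) x →L[ℝ] TangentSpace (𝓡 4) x →L[ℝ] ℝ)
    (he : e ∈ IsManifold.maximalAtlas (𝓡 4) ∞ M)
    (he' : e' ∈ IsManifold.maximalAtlas (𝓡 4) ∞ M) {y : R4}
    (hy : y ∈ e'.target ∩ e'.symm ⁻¹' e.source) (a b : Fin 4) :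
    components h e' y a b = ∑ m, ∑ n, Coord.jacobian (transition e e') m a y *
      Coord.jacobian (transition e e') n b y * components h e (transition e e' y) m n := by
  have hx : e'.symm y = e.symm (transition e e' y) := (e.left_inv hy.2).symm
  have h1 : components h e' y a b = h (e.symm (transition e e' y))
      (coordVector e' y a : R4) (coordVector e' y b : R4) :=
    bilinear_field_congr h hx _ _
  rw [h1, coordVector_transition he he' hy, coordVector_transition he he' hy]
  exact bilinear_apply_sum (h (e.symm (transition e e' y)) : R4 →L[ℝ] R4 →L[ℝ] ℝ) _ _ _ _

theorem IsConformalFactorOn.isPullbackOn (hΩ : IsConformalFactorOn Ω U) (hU : IsOpen U)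
    (g : RiemannianMetric4 M) (he : e ∈ IsManifold.maximalAtlas (𝓡 4) ∞ M)
    (he' : e' ∈ IsManifold.maximalAtlas (𝓡 4) ∞ M) (hUe : U ⊆ e.source) :
    Coord.IsPullbackOn (components (conformalMetric Ω g) e) (components (conformalMetric Ω g) e')
      (transition e e') (e.target ∩ e.symm ⁻¹' U) (e'.target ∩ e'.symm ⁻¹' U) where
  metric := (hΩ.isConformalOn hU g he).metric'
  metric' := (hΩ.isConformalOn hU g he').metric'
  smooth := (contDiffOn_transition he he').mono fun _ hy => ⟨hy.1, hUe hy.2⟩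
  mapsTo y hy := ⟨e.map_source (hUe hy.2), by
    rw [Set.mem_preimage, e.left_inv (hUe hy.2)]; exact hy.2⟩
  eq y hy := components_transition _ he he' ⟨hy.1, hUe hy.2⟩

theorem tensorTConformallyInvariant {g : RiemannianMetric4 M} (hC : WeylNowhereZero g) :
    TensorTConformallyInvariant g := fun _ _ hU hΩ _ he _ hy hyU a b =>
  (hΩ.isConformalOn hU g he).tensorT_eq (weylNormSq_ne_zero_of_weylNowhereZero hC he) ⟨hy, hyU⟩ a b

theorem LocallyConformallyRicciFlat.vanishes {g : RiemannianMetric4 M} (hC : WeylNowhereZero g)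
    (h : LocallyConformallyRicciFlat g) : ScalarInvariantVanishes g ∧ TensorTVanishes g := by
  have key : ∀ e ∈ IsManifold.maximalAtlas (𝓡 4) ∞ M, ∀ y ∈ e.target,
      Coord.scalarInvariant (components g.inner e) y = 0 ∧
        ∀ a b, Coord.tensorT (components g.inner e) a b y = 0 := by
    intro e he y hy
    obtain ⟨U, hU, hyU, Ω, hΩ, hR⟩ := h (e.symm y)
    have hc := hΩ.isConformalOn hU g he
    have hN := weylNormSq_ne_zero_of_weylNowhereZero (U := U) hC he
    have hR' : ∀ z ∈ e.target ∩ e.symm ⁻¹' U, ∀ a b,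
        Coord.ricci (components (conformalMetric Ω g) e) a b z = 0 := fun z hz =>
      hR e he z hz.1 hz.2
    exact ⟨hc.scalarInvariant_eq_zero_of_ricci_eq_zero hN hR' ⟨hy, hyU⟩,
      hc.tensorT_eq_zero_of_ricci_eq_zero hN hR' ⟨hy, hyU⟩⟩
  exact ⟨fun e he y hy => (key e he y hy).1, fun e he y hy => (key e he y hy).2⟩

theorem TensorTVanishes.locallyConformallyRicciFlat {g : RiemannianMetric4 M}
    (hC : WeylNowhereZero g) (hT : TensorTVanishes g) : LocallyConformallyRicciFlat g := by
  intro p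
  set e := chartAt R4 p with he_def
  have he : e ∈ IsManifold.maximalAtlas (𝓡 4) ∞ M := IsManifold.chart_mem_maximalAtlas p
  have hp : p ∈ e.source := mem_chart_source R4 p
  have hg := isMetricOn_components g he
  have hV : ∀ a, ContDiffOn ℝ ∞ (Coord.oneFormV (components g.inner e) a) e.target :=
    hg.smooth_oneFormV fun y hy => hg.weylNormSq_ne_zero hy (hC e he y hy)
  -- A ball in the chart is convex, as the Poincaré lemma requires.
  obtain ⟨r, hr, hball⟩ := Metric.isOpen_iff.1 e.open_target (e p) (e.map_source hp)
  obtain ⟨f, hf, hfV⟩ := Coord.exists_pd_eq_of_pd_symm Metric.isOpen_ball (convex_ball (e p) r)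
    -- The primitive is taken of `-V`, since the rescaling by `exp (2 f)` adds `df` to `V`.
    (V := fun a y => - Coord.oneFormV (components g.inner e) a y)
    (fun a => ((hV a).mono hball).neg) (fun y hy a b => by
      rw [Coord.pd_neg, Coord.pd_neg, hg.pd_oneFormV_symm (hball hy) (hT e he y (hball hy))])
  set U : Set M := e.source ∩ e ⁻¹' Metric.ball (e p) r with hU_def
  have hU : IsOpen U := e.isOpen_inter_preimage Metric.isOpen_ball
  have hΩ : IsConformalFactorOn (fun x => Real.exp (f (e x))) U := by
    refine ⟨?_, fun x _ => Real.exp_pos _⟩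
    have h1 : ContMDiffOn (𝓡 4) 𝓘(ℝ, ℝ) ∞ (fun y => Real.exp (f y)) (Metric.ball (e p) r) :=
      hf.exp.contMDiffOn
    exact h1.comp ((contMDiffOn_of_mem_maximalAtlas he).mono Set.inter_subset_left)
      fun x hx => hx.2
  refine ⟨U, hU, ⟨hp, Metric.mem_ball_self hr⟩, _, hΩ, fun e' he' y hy hyU => ?_⟩
  -- The potential lives in the chart `e`, but Ricci-flatness is asked for in an arbitrary chart
  -- `e'`; it is proved in `e` and carried over by the transition map.
  have hpull := hΩ.isPullbackOn hU g he he' Set.inter_subset_left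
  refine hpull.ricci_eq_zero ⟨hy, hyU⟩ ?_
  have hc := hΩ.isConformalOn hU g he
  refine hc.ricci_eq_zero_of_tensorT_eq_zero (weylNormSq_ne_zero_of_weylNowhereZero hC he)
    (fun z hz => hT e he z hz.1) (fun z hz a => ?_) (hpull.mapsTo ⟨hy, hyU⟩)
  have hlog : ∀ z ∈ e.target ∩ e.symm ⁻¹' U, Real.log (Real.exp (f (e (e.symm z)))) = f z :=
    fun z hz => by rw [Real.log_exp, e.right_inv hz.1]
  have hz' : z ∈ Metric.ball (e p) r := by
    have := hz.2.2
    rwa [Set.mem_preimage, e.right_inv hz.1] at this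
  rw [Coord.pd_congr_on a (e.isOpen_inter_preimage_symm hU) hz hlog, hfV z hz', neg_neg]

end Manifold

end

/-- Anti-self-duality enters only through the identity `C^{bcd}{}_a C_{bcde} = ¼ |C|² g_{ae}`, which
holds for every Weyl tensor in dimension four; this is why `hASD` is not used. -/
theorem theorem1 {M : Type*} [TopologicalSpace M] [ChartedSpace R4 M] [IsManifold (𝓡 4) ∞ M]
    (o : ManifoldOrientation M) (g : RiemannianMetric4 M)
    (hASD : IsAntiSelfDual o g) (hC : WeylNowhereZero g) :
    (LocallyConformallyRicciFlat g ↔ ScalarInvariantVanishes g ∧ TensorTVanishes g) ∧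
      TensorTConformallyInvariant g :=
  ⟨⟨fun h => h.vanishes hC, fun h => h.2.locallyConformallyRicciFlat hC⟩,
    tensorTConformallyInvariant hC⟩
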